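/- **Setting.** Let $\mathcal M=(S,\mathbf P,\mu)$ be a finite Markov chain, let $p_{\min}$ be its smallest positive transition probability, and assume $p_{\min}<1$. A set of states is strongly connected if it is non-empty and any two of its states (equal or not) are joined by a path with at least one edge. A BSCC of a directed graph is a maximal strongly connected set that no edge leaves; a BSCC of a chain is a BSCC of the graph of its positive transition probabilities. For a finite path $\pi$ the candidate $K(\pi)$ is the (unique, if it exists) BSCC of the graph formed by the consecutive pairs of $\pi$ that is the support of a suffix of $\pi$. For real $k$, it is a $k$-candidate of $\pi$ if such a suffix can be chosen in which each state of $K(\pi)$ occurs at least $k$ times and the last state at least $k+1$ times. It is a strong $k$-candidate of $\pi$ if it is a $k$-candidate of the part $b\gamma$ of $\pi$ that starts at the position where it became the candidate. For $\delta\in(0,1)$ let $k_i=\frac{i-\log_2\delta}{-\log_2(1-p_{\min})}$ ($i$ real). $\textsc{ReachedBSCC}(\pi)$ holds iff $K(\pi)$ exists and is a strong $k_i$-candidate of $\pi$, where $i\ge 1$ is the number of times that a candidate different from the previous one has appeared along the prefixes of $\pi$. *Reachability algorithm* (goal set $G\subseteq S$): simulate $\mathcal M$ state by state; after each new state $s$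 answer Yes if $s\in G$, otherwise answer No if $\textsc{ReachedBSCC}$ holds for the current path, otherwise go on. *LTL algorithm* (labelling $L:S\to 2^{Ap}$, deterministic Rabin automaton $\mathcal A$ over $2^{Ap}$ with finite state set $Q$): simulate $\mathcal M$ and record the path of pairs $(s,q)$, where $q$ is the automaton state after reading $L(s)$; stop when $\textsc{ReachedBSCC}$ holds for the path of pairs, and answer Yes iff its candidate $C$ satisfies $C\cap(S\times E)=\emptyset\ne C\cap(S\times F)$ for some acceptance pair $(E,F)$. The running time is the number of simulated states. Let $\mathcal N=\mathcal M$ for the reachability algorithm and let $\mathcal N=\mathcal M\otimes\mathcal A$ be the product chain for the LTL algorithm. Let $R$ be the expected number of steps of $\mathcal N$ before it is in a BSCC, $B$ the maximal size of a BSCC of $\mathcal N$, and $T$ the maximum, over the BSCCs $C$ of $\mathcal N$ and $s,s'\in C$, of the expected time to reach $s'$ from $s$ in at least one step. Let $\varepsilon>0$, $\delta=\varepsilon/2$, $0<p-\varepsilon+\delta$, $p+\varepsilon-\delta<1$, $\alpha,\beta>0$, $\alpha+\beta<1$, and $$\mathit{sim}=\frac{-\log\frac{\beta}{1-\alpha}\,\log\frac{1-\beta}{\alpha}}{\log\frac{p-\varepsilon+\delta}{p+\varepsilon-\delta}\,\log\frac{1-p-\varepsilon+\delta}{1-p+\varepsilon-\delta}}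 .$$ The whole procedure draws independent runs of the single-path algorithm and applies Wald's sequential probability ratio test (SPRT) to their Yes/No answers: with $\theta_0=p+\varepsilon-\delta$ and an alternative $\theta_1$, it stops as soon as the log-likelihood ratio of $\theta_1$ to $\theta_0$ is at most $\log\frac{\beta}{1-\alpha}$ or at least $\log\frac{1-\beta}{\alpha}$. For LTL $\theta_1=p-\varepsilon+\delta$; for reachability $\theta_1>0$ is any number with $p-\varepsilon\le\theta_1\le p-\varepsilon+\delta$. Its running time is the total number of simulated states. **Theorem.** For both algorithms $R<\infty$ and $T\le B/p_{\min}^{B}$; in particular $T\in\mathcal O(B/p_{\min}^B)$. There is an absolute constant $c$ such that for both algorithms the expected running time of a single simulation is at most $$c\cdot k_{R+B}\cdot B\cdot T .$$ For every $\kappa>0$ there is a constant $d$, depending only on $\kappa$, such that for both algorithms the expected running time of the whole procedure is at most $$d\cdot \mathit{sim}\cdot k_{R+B}\cdot B\cdot T ,$$ whenever $$\log\tfrac{1-\alpha}{\beta}\ge\kappa\log\tfrac{p+\varepsilon-\delta}{p-\varepsilon+\delta}\quad\text{and}\quad \log\tfrac{1-\beta}{\alpha}\ge\kappa\log\tfrac{1-p+\varepsilon-\delta}{1-p-\varepsilon+\delta}.$$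 (Every admissible choice of $\alpha,\beta,p,\varepsilon$ satisfies these two conditions for some $\kappa>0$.) -/

import Mathlib

open MeasureTheory ProbabilityTheory
open scoped ENNReal

noncomputable section

/-! ### Strongly connected sets of a directed graph -/

/-- A non-empty set of vertices is strongly connected if any two of its vertices (equal or not)
are joined by a path with at least one edge. For a single vertex this asks for a cycle through it:
a one-letter path has no candidate. -/
def IsSC {V : Type*} (E : V → V → Prop) (C : Finset V) : Prop :=
  C.Nonempty ∧ ∀ s ∈ C, ∀ s' ∈ C, Relation.TransGen E s s'

/-- Bottom strongly connected component: a maximal strongly connected set that no edge leaves. -/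
def IsBSCC {V : Type*} (E : V → V → Prop) (C : Finset V) : Prop :=
  Maximal (IsSC E) C ∧ ∀ s ∈ C, ∀ s', s' ∉ C → ¬ E s s'

/-! ### Markov chains -/

/-- A Markov chain on a (finite) state space `S`: `step s` is the row `P(s, ·)` of the transition
matrix, `start` is the initial distribution. -/
structure MarkovChain (S : Type*) where
  step : S → PMF S
  start : PMF S

namespace MarkovChain

variable {S : Type*}

/-- The transition probability `P(s, s')`. -/
def prob (M : MarkovChain S) (s s' : S) : ℝ := (M.step s s').toReal

/-- The smallest positive transition probability (the set is finite and non-empty when `S` is). -/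
def pmin (M : MarkovChain S) : ℝ := sInf {x : ℝ | 0 < x ∧ ∃ s s', M.prob s s' = x}

/-- The graph of the chain. -/
def edge (M : MarkovChain S) (s s' : S) : Prop := 0 < M.prob s s'

/-- The BSCCs of the chain. -/
def BSCC (M : MarkovChain S) (C : Finset S) : Prop := IsBSCC M.edge C

/-- The same chain, started in the state `s`. -/
def startAt (M : MarkovChain S) (s : S) : MarkovChain S := ⟨M.step, PMF.pure s⟩

/-- The transition kernel of the chain. -/
def kernel [Fintype S] [MeasurableSpace S] [MeasurableSingletonClass S] (M : MarkovChain S) :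
    Kernel S S where
  toFun s := (M.step s).toMeasure
  measurable' := measurable_of_finite _

instance [Fintype S] [MeasurableSpace S] [MeasurableSingletonClass S] (M : MarkovChain S) :
    IsMarkovKernel M.kernel :=
  ⟨fun s => PMF.toMeasure.isProbabilityMeasure (M.step s)⟩

/-- The distribution of the runs of the chain, a measure on the infinite sequences of states. -/
def runMeasure [Fintype S] [MeasurableSpace S] [MeasurableSingletonClass S] (M : MarkovChain S) :
    Measure (ℕ → S) :=
  Kernel.trajMeasure (X := fun _ => S) M.start.toMeasure
    (fun n => M.kernel.comap (fun h => h ⟨n, by simp⟩) (measurable_pi_apply _))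

instance [Fintype S] [MeasurableSpace S] [MeasurableSingletonClass S] (M : MarkovChain S) :
    IsProbabilityMeasure M.runMeasure := by
  unfold runMeasure; infer_instance

end MarkovChain

/-- The first `n` with the property `A`, and `∞` if there is none. -/
def firstTime (A : ℕ → Prop) : ℝ≥0∞ := ⨅ (n : ℕ) (_ : A n), (n : ℝ≥0∞)

namespace MarkovChain

variable {S : Type*} [Fintype S] [MeasurableSpace S] [MeasurableSingletonClass S]

/-- `R`: the expected number of steps before a BSCC is reached. -/
def expReach (M : MarkovChain S) : ℝ≥0∞ :=
  ∫⁻ ρ, firstTime (fun n => ∃ C, M.BSCC C ∧ ρ n ∈ C) ∂M.runMeasure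

open Classical in
/-- `B`: the maximal size of a BSCC. -/
def maxBSCC (M : MarkovChain S) : ℕ :=
  (Finset.univ.filter (fun C : Finset S => M.BSCC C)).sup Finset.card

/-- The expected time to reach `s'` from `s`, in at least one step (so that it is the expected
return time if `s' = s`). -/
def expHit (M : MarkovChain S) (s s' : S) : ℝ≥0∞ :=
  ∫⁻ ρ, firstTime (fun n => 1 ≤ n ∧ ρ n = s') ∂(M.startAt s).runMeasure

/-- `T`: the maximal expected hitting time inside a BSCC. -/
def maxHit (M : MarkovChain S) : ℝ≥0∞ :=
  ⨆ (C : Finset S) (_ : M.BSCC C) (s ∈ C) (s' ∈ C), M.expHit s s'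

end MarkovChain

/-! ### Candidates -/

section Candidates

variable {S : Type*} [DecidableEq S]

/-- The edges of the graph of a path: the pairs of consecutive letters. -/
def pathEdge (π : List S) (s s' : S) : Prop := [s, s'] <:+: π

/-- `C` is the candidate of `π`: the support of a suffix of `π`, and a BSCC of the graph of `π`. -/
def IsCandidate (π : List S) (C : Finset S) : Prop :=
  ∃ κ : List S, κ <:+ π ∧ κ.toFinset = C ∧ IsBSCC (pathEdge π) C

open Classical in
/-- `K(π)`: the candidate of `π` (there is at most one), and `none` if there is no candidate. -/
def candidate (π : List S) : Option (Finset S) :=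
  if h : ∃ C, IsCandidate π C then some h.choose else none

/-- `C` is a `k`-candidate of `π`. -/
def IsKCandidate (k : ℝ) (π : List S) (C : Finset S) : Prop :=
  ∃ κ : List S, κ <:+ π ∧ κ.toFinset = C ∧ IsBSCC (pathEdge π) C ∧
    (∀ s ∈ C, k ≤ (κ.count s : ℝ)) ∧ ∀ l ∈ κ.getLast?, k + 1 ≤ (κ.count l : ℝ)

/-- `C` is a strong `k`-candidate on `π`: with `b` the letter at which `C` becomes the candidate
(its birthday) and `γ` the rest of `π`, it is a `k`-candidate of `bγ`. -/
def IsStrongKCandidate (k : ℝ) (C : Finset S) (π : List S) : Prop :=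
  ∃ (σ : List S) (b : S) (γ : List S), π = σ ++ b :: γ ∧
    candidate σ ≠ some C ∧ candidate (σ ++ [b]) = some C ∧ IsKCandidate k (b :: γ) C

/-- The pair `(C, i)` after the loop over the prefixes of `π`: the last candidate seen, and the
number of changes of the candidate so far. -/
def candidateLoop (π : List S) : Option (Finset S) × ℕ :=
  π.inits.foldl
    (fun c σ => if candidate σ ≠ none ∧ candidate σ ≠ c.1 then (candidate σ, c.2 + 1) else c)
    (none, 0)

/-- The strength `k_i = (i - log δ) / (-log (1 - p))` for a real index `i`, logarithms to
base 2. -/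
def strength (p δ i : ℝ) : ℝ := (i - Real.logb 2 δ) / (-Real.logb 2 (1 - p))

/-- The test ReachedBSCC. -/
def ReachedBSCC (p δ : ℝ) (π : List S) : Prop :=
  1 ≤ (candidateLoop π).2 ∧
    ∃ C, candidate π = some C ∧ IsStrongKCandidate (strength p δ (candidateLoop π).2) C π

/-! ### Simulation of a single run -/

/-- What SinglePathReach does after a new state has been appended to the path: `some true` is the
answer Yes, `some false` is the answer No, `none` means that the loop goes on. -/
noncomputable def reachTest (G : Set S) (p δ : ℝ) (π : List S) : Option Bool :=
  open Classical in
  if ∃ s ∈ π.getLast?, s ∈ G then some true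
  else if ReachedBSCC p δ π then some false
  else none

end Candidates

/-- A deterministic Rabin automaton over the alphabet of the sets of atomic propositions. -/
structure DRA (Ap Q : Type*) where
  next : Q → Set Ap → Q
  start : Q
  acc : Set (Set Q × Set Q)

/-- The candidate `C` of a path in the product satisfies the acceptance condition. -/
def DRA.Accepts {Ap Q S : Type*} (A : DRA Ap Q) (C : Finset (S × Q)) : Prop :=
  ∃ EF ∈ A.acc, (∀ x ∈ C, x.2 ∉ EF.1) ∧ ∃ x ∈ C, x.2 ∈ EF.2

/-- What SinglePathLTL does after a new pair has been appended to the path. -/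
def ltlTest {Ap Q S : Type*} [DecidableEq S] [DecidableEq Q] (A : DRA Ap Q) (p δ : ℝ)
    (π : List (S × Q)) : Option Bool :=
  open Classical in
  if ReachedBSCC p δ π then some (decide (∃ C, candidate π = some C ∧ A.Accepts C))
  else none

/-- The states `q` of the automaton while it reads the labels of the run `ρ`. -/
def DRA.track {Ap Q S : Type*} (A : DRA Ap Q) (L : S → Set Ap) (ρ : ℕ → S) : ℕ → Q
  | 0 => A.next A.start (L (ρ 0))
  | n + 1 => A.next (A.track L ρ n) (L (ρ (n + 1)))

/-- The sequence of pairs `(s, q)` that SinglePathLTL produces from the states of the run `ρ`. -/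
def DRA.lift {Ap Q S : Type*} (A : DRA Ap Q) (L : S → Set Ap) (ρ : ℕ → S) (n : ℕ) : S × Q :=
  (ρ n, A.track L ρ n)

/-- The product of a labelled Markov chain and an automaton. -/
def MarkovChain.product {Ap Q S : Type*} (M : MarkovChain S) (L : S → Set Ap) (A : DRA Ap Q) :
    MarkovChain (S × Q) where
  step x := (M.step x.1).map (fun s' => (s', A.next x.2 (L s')))
  start := M.start.map (fun s => (s, A.next A.start (L s)))

section Simulation

variable {V : Type*}

/-- The path that consists of the first `n` states of the sequence `ρ`. -/
def pathOf (ρ : ℕ → V) (n : ℕ) : List V := (List.range n).map ρ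

/-- The running time of the loop with the given test on the sequence `ρ`: the number of simulated
states, that is of iterations of the loop, until it returns. -/
def runTime (test : List V → Option Bool) (ρ : ℕ → V) : ℝ≥0∞ :=
  firstTime (fun n => 1 ≤ n ∧ test (pathOf ρ n) ≠ none)

/-- The loop returns Yes on the sequence `ρ`. -/
def ReturnsYes (test : List V → Option Bool) (ρ : ℕ → V) : Prop :=
  ∃ n, 1 ≤ n ∧ test (pathOf ρ n) = some true ∧
    ∀ m, 1 ≤ m → m < n → test (pathOf ρ m) = none

end Simulation

/-! ### The sequential probability ratio test -/

section SPRT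

variable {Ω : Type*}

/-- The logarithm of the likelihood ratio of `θ₁` to `θ₀` after the first `n` Bernoulli
observations `X (ω 0), …, X (ω (n - 1))`. -/
def logRatio (θ₀ θ₁ : ℝ) (X : Ω → Prop) (ω : ℕ → Ω) (n : ℕ) : ℝ :=
  open Classical in
  ∑ j ∈ Finset.range n,
    if X (ω j) then Real.log (θ₁ / θ₀) else Real.log ((1 - θ₁) / (1 - θ₀))

/-- The test accepts one of the hypotheses after `n` observations. -/
def SPRTDecides (θ₀ θ₁ α β : ℝ) (X : Ω → Prop) (ω : ℕ → Ω) (n : ℕ) : Prop :=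
  logRatio θ₀ θ₁ X ω n ≤ Real.log (β / (1 - α)) ∨
    Real.log ((1 - β) / α) ≤ logRatio θ₀ θ₁ X ω n

/-- The expected running time of the whole procedure: independent simulations with outcome `X` and
cost `c` are drawn from `ν` until the sequential probability ratio test decides, and the costs of
those that are drawn are added up (simulation `j` is drawn iff the test has not decided after any
number `n ≤ j` of observations). -/
def sprtTime [MeasurableSpace Ω] (ν : Measure Ω) [IsProbabilityMeasure ν] (X : Ω → Prop)
    (c : Ω → ℝ≥0∞) (θ₀ θ₁ α β : ℝ) : ℝ≥0∞ :=
  open Classical in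
  ∫⁻ ω, ∑' j : ℕ, (if ∀ n ≤ j, ¬ SPRTDecides θ₀ θ₁ α β X ω n then c (ω j) else 0)
    ∂(Measure.infinitePi (fun _ : ℕ => ν))

/-- The a priori bound on the number of simulations. -/
def sim (p ε δ α β : ℝ) : ℝ :=
  (-(Real.log (β / (1 - α)) * Real.log ((1 - β) / α))) /
    (Real.log ((p - ε + δ) / (p + ε - δ)) * Real.log ((1 - p - ε + δ) / (1 - p + ε - δ)))

end SPRT

/-- The quantity `k_{R+B} · B · T` of the chain `N`, for the parameters `p` and `δ` of the
strength of candidates. -/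
def MarkovChain.bound {S : Type*} [Fintype S] [MeasurableSpace S] [MeasurableSingletonClass S]
    (N : MarkovChain S) (p δ : ℝ) : ℝ :=
  strength p δ (N.expReach.toReal + N.maxBSCC) * N.maxBSCC * N.maxHit.toReal

end

noncomputable section

/-! ### Candidates of paths -/

section PathGraph

open scoped List

variable {S : Type*}

/-! Both algorithms stop no later than the test ReachedBSCC succeeds, so a single run is bounded by
the time until that test succeeds. Suppose the run enters a bottom component `C` at time `n`. From
then on the path has the form `π₀ ++ π₁`, with `π₀` outside `C` and `π₁` inside. The index of the
current candidate stays at most `n + 1 + 2 * C.card` (`candidateLoop_le`): every change after the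
first letter in `C` strictly raises a potential bounded by twice the size of `C`
(`candidate_change_potential`). So the required strength is bounded in advance, and it is affine in
`n`. Two tours of `C` make `C` the candidate, and about that strength of further tours make it a
strong candidate (`reachedBSCC_of_tours`).

A tour visits the states of `C` in a fixed order, so by the Markov property it costs at most `B * T`
on average (`MarkovChain.lintegral_tourTime_le`). Because the number of tours is affine in `n`,
averaging over the entry time replaces `n` by `R`. This gives
`MarkovChain.lintegral_reachedBSCC_le`, with constant 10. The bound on `T` and the finiteness of `R`
come from one estimate, `MarkovChain.lintegral_hit_le`: in every block of `C.card` steps the target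
is met with probability at least the `C.card`-th power of the smallest transition probability.

For the sequential test, whether simulation `j` is drawn depends only on the earlier ones, so the
expected total cost is the expected number of draws times the expected cost of one run
(`sprtTime_eq`). The log-likelihood ratio is a random walk with steps `-u` and `v`. Its exit time
from `(-a, b)` is bounded through a Lyapunov function (`tsum_undecided_le`), which yields `4 * (1 +
a / u) * (1 + b / v)` uniformly in the step probability (`exists_exitLyapunov`). The conditions with
`κ` absorb the two summands 1, and what remains is a multiple of `sim`.

The LTL algorithm reduces to the same chain estimate, because lifted runs have the law of the
product chain (`MarkovChain.product_runMeasure`) and the product has the same smallest positive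
probability (`MarkovChain.pmin_product`). -/

lemma pathEdge_iff {π : List S} {s s' : S} :
    pathEdge π s s' ↔ ∃ α β, π = α ++ s :: s' :: β := by
  simp [pathEdge, List.IsInfix, eq_comm]

lemma pathEdge.mono {τ π : List S} (h : τ <:+: π) {s s' : S} (he : pathEdge τ s s') :
    pathEdge π s s' :=
  List.IsInfix.trans he h

lemma transGen_pathEdge_mono {τ π : List S} (h : τ <:+: π) {s s' : S}
    (he : Relation.TransGen (pathEdge τ) s s') : Relation.TransGen (pathEdge π) s s' :=
  Relation.TransGen.mono (fun _ _ => pathEdge.mono h) s s' he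

lemma transGen_pathEdge_of_mem (α : List S) (a : S) {β : List S} {b : S} (hb : b ∈ β) :
    Relation.TransGen (pathEdge (α ++ a :: β)) a b := by
  induction β generalizing α a with
  | nil => simp at hb
  | cons c β ih =>
    have he : pathEdge (α ++ a :: c :: β) a c := pathEdge_iff.2 ⟨α, β, rfl⟩
    rcases List.mem_cons.1 hb with rfl | hb
    · exact .single he
    · have := ih (α ++ [a]) c hb
      rw [List.append_assoc] at this
      exact .head he this

lemma pathEdge_append_singleton {τ : List S} {l x s s' : S}
    (h : pathEdge (τ ++ [l] ++ [x]) s s') :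
    pathEdge (τ ++ [l]) s s' ∨ s = l ∧ s' = x := by
  obtain ⟨α, β, h⟩ := pathEdge_iff.1 h
  rcases List.eq_nil_or_concat β with rfl | ⟨β, b, rfl⟩
  · right
    have h' : (τ ++ [l]) ++ [x] = (α ++ [s]) ++ [s'] := by simpa using h
    have h1 := List.append_inj' h' rfl
    have h2 := List.append_inj' h1.1 rfl
    simp at h1 h2
    exact ⟨h2.2.symm, h1.2.symm⟩
  · left
    have h' : (τ ++ [l]) ++ [x] = (α ++ s :: s' :: β) ++ [b] := by simpa using h
    exact pathEdge_iff.2 ⟨α, β, (List.append_inj' h' rfl).1⟩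

/-- The source of an edge is followed by another letter, so it occurs before the final position.
Hence a fresh last letter has no outgoing edge. -/
lemma mem_of_pathEdge {τ : List S} {l s s' : S} (h : pathEdge (τ ++ [l]) s s') : s ∈ τ := by
  obtain ⟨α, β, h⟩ := pathEdge_iff.1 h
  have := congrArg List.dropLast h
  rw [List.dropLast_concat, List.dropLast_append_of_ne_nil (by simp)] at this
  rw [this]
  simp

lemma mem_right_of_pathEdge {π : List S} {s s' : S} (h : pathEdge π s s') : s' ∈ π := by
  obtain ⟨α, β, rfl⟩ := pathEdge_iff.1 h
  simp

lemma mem_right_of_transGen {π : List S} {s s' : S}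
    (h : Relation.TransGen (pathEdge π) s s') : s' ∈ π := by
  obtain ⟨b, -, h⟩ := Relation.TransGen.tail'_iff.1 h
  exact mem_right_of_pathEdge h

lemma mem_of_transGen_pathEdge {τ : List S} {l s s' : S}
    (h : Relation.TransGen (pathEdge (τ ++ [l])) s s') : s ∈ τ := by
  obtain ⟨b, h, -⟩ := Relation.TransGen.head'_iff.1 h
  exact mem_of_pathEdge h

lemma mem_of_transGen_of_closed {E : S → S → Prop} {D : S → Prop}
    (hcl : ∀ s, D s → ∀ s', E s s' → D s') {s s' : S} (hs : D s)
    (h : Relation.TransGen E s s') : D s' := by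
  induction h with
  | single h => exact hcl _ hs _ h
  | tail _ h ih => exact hcl _ ih _ h

/-- Maximality is automatic: all states of a strongly connected superset are reachable from `C`,
which no edge leaves. -/
lemma isBSCC_of_isSC_of_closed {E : S → S → Prop} {C : Finset S} (h : IsSC E C)
    (hcl : ∀ s ∈ C, ∀ s', E s s' → s' ∈ C) : IsBSCC E C := by
  refine ⟨⟨h, fun D hD hCD d hd => ?_⟩, fun s hs s' hs' he => hs' (hcl s hs s' he)⟩
  obtain ⟨c, hc⟩ := h.1
  exact mem_of_transGen_of_closed (D := (· ∈ C)) hcl hc (hD.2 c (hCD hc) d hd)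

lemma pathEdge_closed {C : Finset S} {π₀ π₁ : List S} (h0 : ∀ x ∈ π₀, x ∉ C)
    (h1 : ∀ x ∈ π₁, x ∈ C) (s : S) (hs : s ∈ C) (s' : S) (h : pathEdge (π₀ ++ π₁) s s') :
    s' ∈ C := by
  obtain ⟨α, β, h⟩ := pathEdge_iff.1 h
  rcases List.append_eq_append_iff.1 h with ⟨γ, hα, hγ⟩ | ⟨γ, hα, hγ⟩
  · exact h1 _ (by rw [hγ]; simp)
  · cases γ with
    | nil => exact h1 _ (by simp at hγ; rw [← hγ]; simp)
    | cons g γ =>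
      simp at hγ
      exact absurd hs (h0 s (by rw [hα, hγ.1]; simp))

/-- Supplies the birthday of a candidate: a letter at which the property switches from false to
true. -/
lemma exists_prefix_of_not_nil {P : List S → Prop} (h0 : ¬ P []) {w : List S} (hw : P w) :
    ∃ σ b γ, w = σ ++ b :: γ ∧ ¬ P σ ∧ P (σ ++ [b]) := by
  induction w using List.reverseRecOn with
  | nil => exact absurd hw h0
  | append_singleton w a ih =>
    by_cases h : P w
    · obtain ⟨σ, b, γ, rfl, h1, h2⟩ := ih h
      exact ⟨σ, b, γ ++ [a], by simp, h1, h2⟩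
    · exact ⟨w, a, [], rfl, h, hw⟩

/-- An occurrence of `s` in the first copy of `T` precedes one of `s'` in the second, and the path
itself connects them. -/
lemma isSC_of_append_sublist {C : Finset S} (hC : C.Nonempty) {T π : List S}
    (hT : ∀ x ∈ C, x ∈ T) (h : T ++ T <+ π) : IsSC (pathEdge π) C := by
  refine ⟨hC, fun s hs s' hs' => ?_⟩
  obtain ⟨u, v, rfl, hu, hv⟩ := List.append_sublist_iff.1 h
  obtain ⟨α, β, rfl⟩ := List.append_of_mem (hu.subset (hT s hs))
  have : s' ∈ β ++ v := List.mem_append_right _ (hv.subset (hT s' hs'))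
  have := transGen_pathEdge_of_mem α s this
  simpa using this

open Classical in
/-- The states of `C` that lie on a cycle of the graph of `σ`. -/
def cycleStates (C : Finset S) (σ : List S) : Finset S :=
  C.filter (fun x => Relation.TransGen (pathEdge σ) x x)

lemma cycleStates_mono (C : Finset S) (σ : List S) (x : S) :
    cycleStates C σ ⊆ cycleStates C (σ ++ [x]) := by
  intro z hz
  simp only [cycleStates, Finset.mem_filter] at hz ⊢
  exact ⟨hz.1, transGen_pathEdge_mono (List.prefix_append _ _).isInfix hz.2⟩

variable [DecidableEq S]

lemma transGen_of_idxOf_lt {σ : List S} {x y : S} (hx : x ∈ σ) (h : σ.idxOf y < σ.idxOf x) :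
    Relation.TransGen (pathEdge σ) y x := by
  have hy : y ∈ σ := by
    have := List.idxOf_lt_length_of_mem hx
    exact List.idxOf_lt_length_iff.1 (h.trans this)
  obtain ⟨α, β, rfl, hα⟩ := List.eq_append_cons_of_mem hy
  have h1 : (α ++ y :: β).idxOf y = α.length := by
    rw [List.idxOf_append_of_notMem hα]; simp
  rcases List.mem_append.1 hx with hx' | hx'
  · rw [h1, List.idxOf_append_of_mem hx'] at h
    exact absurd (List.idxOf_lt_length_of_mem hx') (by omega)
  · rcases List.mem_cons.1 hx' with rfl | hx'
    · exact absurd h (lt_irrefl _)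
    · exact transGen_pathEdge_of_mem α y hx'

lemma IsCandidate.last_mem {τ : List S} {l : S} {C : Finset S} (h : IsCandidate (τ ++ [l]) C) :
    l ∈ C := by
  obtain ⟨κ, hκ, rfl, hB⟩ := h
  rcases List.eq_nil_or_concat κ with rfl | ⟨κ, a, rfl⟩
  · simpa using hB.1.1.1
  · obtain ⟨t, ht⟩ := hκ
    have h' : (t ++ κ) ++ [a] = τ ++ [l] := by simpa using ht
    have := (List.append_inj' h' rfl).2
    simp at this
    simp [this]

/-- The last letter lies in the candidate, which is strongly connected and closed. So the candidate
is determined by the graph and the last letter, which yields uniqueness. -/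
lemma IsCandidate.mem_iff {τ : List S} {l : S} {C : Finset S} (h : IsCandidate (τ ++ [l]) C)
    (z : S) : z ∈ C ↔ Relation.TransGen (pathEdge (τ ++ [l])) l z := by
  have hl := h.last_mem
  obtain ⟨κ, hκ, hκC, hB⟩ := h
  refine ⟨fun hz => hB.1.1.2 l hl z hz, fun hz => ?_⟩
  refine mem_of_transGen_of_closed (D := (· ∈ C)) (fun s hs s' he => ?_) hl hz
  by_contra hs'
  exact hB.2 s hs s' hs' he

lemma not_isCandidate_nil (C : Finset S) : ¬ IsCandidate ([] : List S) C := by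
  rintro ⟨κ, hκ, rfl, hB⟩
  obtain rfl := List.suffix_nil.1 hκ
  simpa using hB.1.1.1

lemma IsCandidate.unique {π : List S} {C D : Finset S} (hC : IsCandidate π C)
    (hD : IsCandidate π D) : C = D := by
  rcases List.eq_nil_or_concat π with rfl | ⟨τ, l, rfl⟩
  · exact absurd hC (not_isCandidate_nil C)
  · rw [List.concat_eq_append] at hC hD
    ext z
    rw [hC.mem_iff, hD.mem_iff]

lemma candidate_eq_some_iff {π : List S} {C : Finset S} :
    candidate π = some C ↔ IsCandidate π C := by
  unfold candidate
  constructor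
  · intro h
    split_ifs at h with hex
    rw [← Option.some.inj h]
    exact hex.choose_spec
  · intro h
    have hex : ∃ C, IsCandidate π C := ⟨C, h⟩
    rw [dif_pos hex, hex.choose_spec.unique h]

lemma candidate_nil : candidate ([] : List S) = none := by
  rw [Option.eq_none_iff_forall_ne_some]
  exact fun C h => not_isCandidate_nil C (candidate_eq_some_iff.1 h)

/-- Every state of the path reaches the last letter along the path, and a repeated last letter also
reaches itself. Hence the states reachable from `l` form a closed strongly connected set. -/
lemma exists_isCandidate {τ : List S} {l : S} (hl : l ∈ τ) : ∃ C, IsCandidate (τ ++ [l]) C := by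
  classical
  set π := τ ++ [l] with hπ
  set R : S → Prop := fun z => Relation.TransGen (pathEdge π) l z with hR
  have hto : ∀ z ∈ τ, Relation.TransGen (pathEdge π) z l := by
    intro z hz
    obtain ⟨α, β, rfl⟩ := List.append_of_mem hz
    have := transGen_pathEdge_of_mem α z (show l ∈ β ++ [l] by simp)
    simpa [hπ] using this
  have hto' : ∀ z ∈ π, Relation.TransGen (pathEdge π) z l := by
    intro z hz
    rcases List.mem_append.1 hz with hz | hz
    · exact hto z hz
    · rw [List.mem_singleton.1 hz]; exact hto l hl
  have hRl : R l := hto l hl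
  -- The suffix starts at the first state reachable from `l`; everything after it is reachable as
  -- well, so its support is exactly the reachable set.
  set κ := π.dropWhile (fun z => ¬ R z) with hκ
  have hsplit : π.takeWhile (fun z => ¬ R z) ++ κ = π := List.takeWhile_append_dropWhile
  have hmem : ∀ z, z ∈ κ ↔ R z := by
    intro z
    constructor
    · intro hz
      have hne : κ ≠ [] := List.ne_nil_of_mem hz
      obtain ⟨a, κ', hκ'⟩ := List.exists_cons_of_ne_nil hne
      have ha : R a := by
        have := List.head_dropWhile_not (p := fun z => decide (¬ R z)) (l := π) hne
        have h2 : κ.head hne = a := by simp [hκ']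
        have h3 : (π.dropWhile (fun z => decide (¬ R z))).head hne = a := h2
        rw [h3] at this
        simpa using this
      rw [hκ'] at hz hsplit
      rcases List.mem_cons.1 hz with rfl | hz
      · exact ha
      · have := transGen_pathEdge_of_mem (π.takeWhile (fun z => ¬ R z)) a hz
        rw [hsplit] at this
        exact Relation.TransGen.trans ha this
    · intro hz
      have hzπ : z ∈ π := mem_right_of_transGen hz
      rw [← hsplit] at hzπ
      rcases List.mem_append.1 hzπ with h | h
      · have := List.mem_takeWhile_imp h
        simp [hz] at this
      · exact h
  refine ⟨κ.toFinset, κ, List.dropWhile_suffix _, rfl, isBSCC_of_isSC_of_closed ⟨⟨l, ?_⟩, ?_⟩ ?_⟩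
  · exact List.mem_toFinset.2 ((hmem l).2 hRl)
  · intro s hs s' hs'
    rw [List.mem_toFinset, hmem] at hs hs'
    exact (hto' s (mem_right_of_transGen hs)).trans hs'
  · intro s hs s' he
    rw [List.mem_toFinset, hmem] at hs ⊢
    exact hs.tail he

lemma candidateLoop_append_singleton (σ : List S) (x : S) :
    candidateLoop (σ ++ [x]) =
      if candidate (σ ++ [x]) ≠ none ∧ candidate (σ ++ [x]) ≠ (candidateLoop σ).1 then
        (candidate (σ ++ [x]), (candidateLoop σ).2 + 1) else candidateLoop σ := by
  unfold candidateLoop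
  rw [List.inits_append, List.foldl_append]
  simp

lemma candidateLoop_fst {π : List S} (h : candidate π ≠ none) :
    (candidateLoop π).1 = candidate π := by
  rcases List.eq_nil_or_concat π with rfl | ⟨τ, l, rfl⟩
  · exact absurd candidate_nil h
  · rw [List.concat_eq_append] at h ⊢
    rw [candidateLoop_append_singleton]
    split_ifs with h'
    · rfl
    · by_contra hne
      exact h' ⟨h, fun he => hne he.symm⟩

lemma candidateLoop_nil : candidateLoop ([] : List S) = (none, 0) := by
  simp [candidateLoop, candidate_nil]

lemma one_le_candidateLoop {π : List S} (h : (candidateLoop π).1 ≠ none) :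
    1 ≤ (candidateLoop π).2 := by
  induction π using List.reverseRecOn with
  | nil => rw [candidateLoop_nil] at h; exact absurd rfl h
  | append_singleton τ l ih =>
    rw [candidateLoop_append_singleton] at h ⊢
    split_ifs at h ⊢ with h'
    · omega
    · exact ih h

lemma candidateLoop_le_length (π : List S) : (candidateLoop π).2 ≤ π.length := by
  induction π using List.reverseRecOn with
  | nil => rw [candidateLoop_nil]; simp
  | append_singleton τ l ih =>
    rw [candidateLoop_append_singleton]
    split_ifs
    · simp; omega
    · simp; omega

/-! ### Counting the changes of the candidate. -/

open Classical in
/-- The states of `C` from which the graph of `σ` reaches a state that was visited earlier. -/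
def nonLeaders (C : Finset S) (σ : List S) : Finset S :=
  C.filter (fun x => x ∈ σ ∧ ∃ y, σ.idxOf y < σ.idxOf x ∧ Relation.TransGen (pathEdge σ) x y)

lemma nonLeaders_mono (C : Finset S) (σ : List S) (x : S) :
    nonLeaders C σ ⊆ nonLeaders C (σ ++ [x]) := by
  intro z hz
  simp only [nonLeaders, Finset.mem_filter] at hz ⊢
  obtain ⟨hzC, hzσ, y, hy, ht⟩ := hz
  refine ⟨hzC, by simp [hzσ], y, ?_, transGen_pathEdge_mono (List.prefix_append _ _).isInfix ht⟩
  rw [List.idxOf_append_of_mem hzσ, List.idxOf_append_of_mem (mem_right_of_transGen ht)]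
  exact hy

/-- A change has one of two causes. Either the fresh letter `l` is closed into a cycle for the first
time, or the step from `l` leaves the current candidate for an older state, so that the oldest state
of that candidate stops being the oldest one it reaches. Both effects are irreversible and happen at
most once per state. -/
lemma candidate_change_potential {C : Finset S} {τ : List S} {l x : S} (hl : l ∈ C)
    (hcl : ∀ s ∈ C, ∀ s', pathEdge (τ ++ [l]) s s' → s' ∈ C)
    (h1 : candidate (τ ++ [l] ++ [x]) ≠ none)
    (h2 : candidate (τ ++ [l] ++ [x]) ≠ (candidateLoop (τ ++ [l])).1) :
    (cycleStates C (τ ++ [l])).card + (nonLeaders C (τ ++ [l])).card <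
      (cycleStates C (τ ++ [l] ++ [x])).card + (nonLeaders C (τ ++ [l] ++ [x])).card := by
  obtain ⟨D', hD'⟩ := Option.ne_none_iff_exists'.1 h1
  have hcand := candidate_eq_some_iff.1 hD'
  -- A candidate exists after the step, so `x` lies on a cycle and must have occurred before.
  have hx : x ∈ τ ++ [l] := mem_of_transGen_pathEdge ((hcand.mem_iff x).1 hcand.last_mem)
  have hlx : pathEdge (τ ++ [l] ++ [x]) l x := pathEdge_iff.2 ⟨τ, [], by simp⟩
  by_cases hlτ : l ∈ τ
  · obtain ⟨D, hD⟩ := exists_isCandidate hlτ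
    have hD2 := candidate_eq_some_iff.2 hD
    have hDl := hD.last_mem
    have hmem := hD.mem_iff
    have hSC : ∀ s ∈ D, ∀ s' ∈ D, Relation.TransGen (pathEdge (τ ++ [l])) s s' := by
      obtain ⟨_, _, _, hB⟩ := hD
      exact hB.1.1.2
    have hDcl : ∀ s ∈ D, ∀ s', pathEdge (τ ++ [l]) s s' → s' ∈ D := by
      intro s hs s' he
      rw [hmem] at hs ⊢
      exact hs.tail he
    rw [candidateLoop_fst (by rw [hD2]; simp), hD2, hD'] at h2
    have hxD : x ∉ D := by
      intro hxD
      apply h2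
      congr 1
      ext z
      rw [hcand.mem_iff]
      constructor
      · intro hz
        refine mem_of_transGen_of_closed (D := (· ∈ D)) (fun s hs s' he => ?_) hxD hz
        rcases pathEdge_append_singleton he with he | ⟨_, rfl⟩
        · exact hDcl s hs s' he
        · exact hxD
      · intro hz
        exact transGen_pathEdge_mono (List.prefix_append _ _).isInfix (hSC x hxD z hz)
    -- The first visited state `y` of `D` is the new non-leader. Were `x` first visited after `y`,
    -- the path would lead from `y` to `x` and put `x` into the closed set `D`.
    obtain ⟨y, hyD, hymin⟩ := D.exists_min_image (fun z => (τ ++ [l]).idxOf z) ⟨l, hDl⟩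
    have hyσ : y ∈ τ ++ [l] := mem_right_of_transGen ((hmem y).1 hyD)
    have hxy : (τ ++ [l]).idxOf x < (τ ++ [l]).idxOf y := by
      by_contra hcon
      rcases Nat.lt_or_eq_of_le (not_lt.1 hcon) with hlt | heq
      · exact hxD (mem_of_transGen_of_closed (D := (· ∈ D)) hDcl hyD (transGen_of_idxOf_lt hx hlt))
      · exact hxD (by rw [← (List.idxOf_inj hyσ).1 heq]; exact hyD)
    have hyC : y ∈ C := mem_of_transGen_of_closed (D := (· ∈ C)) hcl hl ((hmem y).1 hyD)
    have hlt : (nonLeaders C (τ ++ [l])).card < (nonLeaders C (τ ++ [l] ++ [x])).card := by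
      apply Finset.card_lt_card
      refine Finset.ssubset_iff_subset_ne.2 ⟨nonLeaders_mono C _ x, fun heq => ?_⟩
      have hy1 : y ∈ nonLeaders C (τ ++ [l] ++ [x]) := by
        simp only [nonLeaders, Finset.mem_filter]
        refine ⟨hyC, List.mem_append_left _ hyσ, x, ?_, ?_⟩
        · rwa [List.idxOf_append_of_mem hx, List.idxOf_append_of_mem hyσ]
        · exact (transGen_pathEdge_mono (List.prefix_append _ _).isInfix
            (hSC y hyD l hDl)).tail hlx
      rw [← heq] at hy1
      simp only [nonLeaders, Finset.mem_filter] at hy1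
      obtain ⟨_, _, z, hz, ht⟩ := hy1
      have hzD : z ∈ D := mem_of_transGen_of_closed (D := (· ∈ D)) hDcl hyD ht
      exact absurd (hymin z hzD) (by omega)
    have := Finset.card_le_card (cycleStates_mono C (τ ++ [l]) x)
    omega
  -- Here `l` is fresh, so it has no outgoing edge yet; the edge to the old state `x` closes its
  -- first cycle.
  · have hlt : (cycleStates C (τ ++ [l])).card < (cycleStates C (τ ++ [l] ++ [x])).card := by
      apply Finset.card_lt_card
      refine Finset.ssubset_iff_subset_ne.2 ⟨cycleStates_mono C _ x, fun heq => ?_⟩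
      have hl1 : l ∈ cycleStates C (τ ++ [l] ++ [x]) := by
        simp only [cycleStates, Finset.mem_filter]
        refine ⟨hl, ?_⟩
        rcases List.mem_append.1 hx with hxτ | hxl
        · obtain ⟨α, β, rfl⟩ := List.append_of_mem hxτ
          have := transGen_pathEdge_of_mem α x (show l ∈ β ++ [l] ++ [x] by simp)
          refine .head hlx ?_
          simpa using this
        · obtain rfl := List.mem_singleton.1 hxl
          exact .single hlx
      rw [← heq] at hl1
      simp only [cycleStates, Finset.mem_filter] at hl1
      exact hlτ (mem_of_transGen_pathEdge hl1.2)
    have := Finset.card_le_card (nonLeaders_mono C (τ ++ [l]) x)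
    omega

/-- The number of changes of the candidate on a path that enters `C` and then stays there. -/
lemma candidateLoop_le {C : Finset S} {π₀ : List S} (h0 : ∀ x ∈ π₀, x ∉ C) {π₁ : List S}
    (h1 : ∀ x ∈ π₁, x ∈ C) : (candidateLoop (π₀ ++ π₁)).2 ≤ π₀.length + 1 + 2 * C.card := by
  have key : (candidateLoop (π₀ ++ π₁)).2 ≤ π₀.length + 1 +
      ((cycleStates C (π₀ ++ π₁)).card + (nonLeaders C (π₀ ++ π₁)).card) := by
    induction π₁ using List.reverseRecOn with
    | nil =>
      have := candidateLoop_le_length π₀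
      simp only [List.append_nil]; omega
    | append_singleton τ x ih =>
      have ih := ih (fun z hz => h1 z (List.mem_append_left _ hz))
      rcases List.eq_nil_or_concat τ with rfl | ⟨τ, l, rfl⟩
      -- The potential argument needs the previous letter to be in `C`, so the first letter in `C`
      -- is charged to the length. This is the summand 1.
      · have := candidateLoop_le_length (π₀ ++ [x])
        simp at this ⊢; omega
      · rw [List.concat_eq_append] at ih h1 ⊢
        have hcl := pathEdge_closed (C := C) h0 (π₁ := τ ++ [l])
          (fun z hz => h1 z (List.mem_append_left _ hz))
        have hlC : l ∈ C := h1 l (by simp)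
        rw [← List.append_assoc, ← List.append_assoc, candidateLoop_append_singleton]
        rw [← List.append_assoc] at ih hcl
        split_ifs with h
        · have := candidate_change_potential hlC hcl h.1 h.2
          simp only; omega
        · have h2 := Finset.card_le_card (cycleStates_mono C (π₀ ++ τ ++ [l]) x)
          have h3 := Finset.card_le_card (nonLeaders_mono C (π₀ ++ τ ++ [l]) x)
          omega
  have h2 : (cycleStates C (π₀ ++ π₁)).card ≤ C.card := by
    classical exact Finset.card_filter_le _ _
  have h3 : (nonLeaders C (π₀ ++ π₁)).card ≤ C.card := by
    classical exact Finset.card_filter_le _ _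
  omega

/-! ### Tours of a bottom component force the test to succeed. -/

lemma isCandidate_of_append_sublist {C : Finset S} (hC : C.Nonempty) {π₀ π₁ T : List S}
    (h0 : ∀ x ∈ π₀, x ∉ C) (h1 : ∀ x ∈ π₁, x ∈ C) (hT : ∀ x ∈ C, x ∈ T) (h : T ++ T <+ π₁) :
    IsCandidate (π₀ ++ π₁) C := by
  refine ⟨π₁, List.suffix_append _ _, ?_, isBSCC_of_isSC_of_closed ?_ (pathEdge_closed h0 h1)⟩
  · ext x
    rw [List.mem_toFinset]
    exact ⟨h1 x, fun hx => h.subset (List.mem_append_left _ (hT x hx))⟩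
  · exact isSC_of_append_sublist hC hT (h.trans (List.sublist_append_right _ _))

/-- A path that enters `C`, stays there and makes sufficiently many tours of `C` passes the test. -/
lemma reachedBSCC_of_tours {C : Finset S} (hC : C.Nonempty) {π₀ π₁ T : List S}
    (h0 : ∀ x ∈ π₀, x ∉ C) (h1 : ∀ x ∈ π₁, x ∈ C) (hT : ∀ x ∈ C, x ∈ T) {r : ℕ}
    (hr : 4 ≤ r) (h : (List.replicate r T).flatten <+ π₁) {p δ : ℝ}
    (hk : ∀ i : ℕ, i ≤ π₀.length + 1 + 2 * C.card → strength p δ i + 3 ≤ r) :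
    ReachedBSCC p δ (π₀ ++ π₁) := by
  obtain ⟨r, rfl⟩ : ∃ n, r = n + 4 := ⟨r - 4, by omega⟩
  have hTT : T ++ T <+ π₁ := by
    refine List.Sublist.trans ?_ h
    simp only [List.replicate_succ, List.flatten_cons, ← List.append_assoc]
    exact (List.sublist_append_left _ _).trans
      ((List.sublist_append_left _ _).trans (List.sublist_append_left _ _))
  have hcand := isCandidate_of_append_sublist hC h0 h1 hT hTT
  have hcand' := candidate_eq_some_iff.2 hcand
  have hcount := candidateLoop_le h0 h1
  refine ⟨one_le_candidateLoop (by rw [candidateLoop_fst] <;> simp [hcand']), C, hcand', ?_⟩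
  have hstr := hk _ hcount
  -- Two tours are spent on the birth of the candidate. The remaining ones, at least two, must both
  -- supply the counts and make `C` strongly connected in the graph of the part after the birthday
  -- alone.
  obtain ⟨u, v, rfl, hu, hv⟩ : ∃ u v, π₁ = u ++ v ∧ T ++ T <+ u ∧
      (List.replicate (r + 2) T).flatten <+ v := by
    have : (List.replicate (r + 4) T).flatten = (T ++ T) ++ (List.replicate (r + 2) T).flatten := by
      simp [List.replicate_succ]
    rw [this] at h
    exact List.append_sublist_iff.1 h
  have hu1 : ∀ x ∈ u, x ∈ C := fun x hx => h1 x (List.mem_append_left _ hx)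
  have hv1 : ∀ x ∈ v, x ∈ C := fun x hx => h1 x (List.mem_append_right _ hx)
  -- The birthday letter lies in `C`, so it falls inside `u`, and the whole part from it onwards
  -- stays in `C`.
  obtain ⟨σ, b, γ, hw, hσ, hb⟩ := exists_prefix_of_not_nil
    (P := fun w => candidate w = some C) (by simp [candidate_nil])
    (candidate_eq_some_iff.2 (isCandidate_of_append_sublist hC h0 hu1 hT hu))
  have hbC := (candidate_eq_some_iff.1 hb).last_mem
  have hγ : ∀ x ∈ γ, x ∈ C := by
    intro x hx
    rcases List.append_eq_append_iff.1 hw with ⟨η, hα, hη⟩ | ⟨η, hα, hη⟩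
    · exact hu1 x (by rw [hη]; simp [hx])
    · cases η with
      | nil => exact hu1 x (by simp at hη; rw [← hη]; simp [hx])
      | cons g η =>
        simp at hη
        exact absurd hbC (h0 b (by rw [hα, hη.1]; simp))
  have hall : ∀ x ∈ b :: (γ ++ v), x ∈ C := by
    intro x hx
    rcases List.mem_cons.1 hx with rfl | hx
    · exact hbC
    · rcases List.mem_append.1 hx with hx | hx
      · exact hγ x hx
      · exact hv1 x hx
  have hvsub : v <+ b :: (γ ++ v) :=
    (List.sublist_append_right γ v).trans (List.sublist_cons_self _ _)
  have hTv : T ++ T <+ v := by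
    refine List.Sublist.trans ?_ hv
    simp only [List.replicate_succ, List.flatten_cons, ← List.append_assoc]
    exact List.sublist_append_left _ _
  -- After the renaming `r = n + 4`, `hk` says that the strength plus 1 is at most `r + 2`, which is
  -- what the last letter requires.
  have hcnt : ∀ s ∈ C, r + 2 ≤ (b :: (γ ++ v)).count s := by
    intro s hs
    have h2 := (hv.trans hvsub).count_le s
    rw [List.count_flatten, List.map_replicate, List.sum_replicate, smul_eq_mul] at h2
    have h3 : 1 ≤ T.count s := List.count_pos_iff.2 (hT s hs)
    nlinarith
  refine ⟨σ, b, γ ++ v, ?_, hσ, hb, b :: (γ ++ v), List.suffix_rfl, ?_, ?_, ?_, ?_⟩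
  · rw [← List.append_assoc, hw]; simp
  · ext x
    rw [List.mem_toFinset]
    exact ⟨hall x, fun hx => hvsub.subset (hTv.subset (List.mem_append_left _ (hT x hx)))⟩
  · refine isBSCC_of_isSC_of_closed (isSC_of_append_sublist hC hT (hTv.trans hvsub)) ?_
    exact fun s _ s' he => hall s' (mem_right_of_pathEdge he)
  · intro s hs
    have : ((r + 2 : ℕ) : ℝ) ≤ ((b :: (γ ++ v)).count s : ℝ) := by exact_mod_cast hcnt s hs
    push_cast at this hstr
    linarith
  · intro l hl
    have : ((r + 2 : ℕ) : ℝ) ≤ ((b :: (γ ++ v)).count l : ℝ) := by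
      exact_mod_cast hcnt l (hall l (List.mem_of_mem_getLast? hl))
    push_cast at this hstr
    linarith

end PathGraph

/-! ### A Lyapunov function for the two-valued random walk -/

section Lyapunov

/-- `f` is a Lyapunov function for the exit from `(-a, b)` of the walk with steps `-u` (with
probability `q`) and `v` that decreases by `c` on average. -/
structure IsExitLyapunov (q u v a b : ℝ) (f : ℝ → ℝ) (c : ℝ) : Prop where
  measurable : Measurable f
  pos : 0 < c
  nonneg : ∀ x, -(a + u) ≤ x → x ≤ b + v → 0 ≤ f x
  drift : ∀ x, -a < x → x < b → q * f (x - u) + (1 - q) * f (x + v) + c ≤ f x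

lemma IsExitLyapunov.symm {q u v a b c : ℝ} {f : ℝ → ℝ} (h : IsExitLyapunov (1 - q) v u b a f c) :
    IsExitLyapunov q u v a b (fun x => f (-x)) c where
  measurable := h.measurable.comp measurable_neg
  pos := h.pos
  nonneg x h1 h2 := h.nonneg _ (by linarith) (by linarith)
  drift x h1 h2 := by
    have := h.drift (-x) (by linarith) (by linarith)
    rw [show -(x - u) = -x + u by ring, show -(x + v) = -x - v by ring]
    linarith

/-- The distance to the farthest overshoot point `b + v` falls by the mean step. -/
lemma exitLyapunov_linear {q u v a b : ℝ} (hm : 0 < (1 - q) * v - q * u) :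
    IsExitLyapunov q u v a b (fun x => b + v - x) ((1 - q) * v - q * u) where
  measurable := by fun_prop
  pos := hm
  nonneg x _ h := by linarith
  drift x _ _ := by nlinarith

/-- Without drift, a concave quadratic loses the second moment of a step, which is `u * v`. -/
lemma exitLyapunov_quadratic {q u v a b : ℝ} (hu : 0 < u) (hv : 0 < v)
    (hm : (1 - q) * v = q * u) :
    IsExitLyapunov q u v a b (fun x => (x + (a + u)) * (b + v - x)) (u * v) where
  measurable := by fun_prop
  pos := mul_pos hu hv
  nonneg x h1 h2 := mul_nonneg (by linarith) (by linarith)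
  drift x _ _ := by
    have h1 : v = q * u + q * v := by linarith
    have h2 : q * u * u + (1 - q) * v * v = u * v := by
      rw [hm]; linear_combination (-u) * h1
    have h3 : q * ((x - u + (a + u)) * (b + v - (x - u))) +
        (1 - q) * ((x + v + (a + u)) * (b + v - (x + v))) =
        (x + (a + u)) * (b + v - x) + ((b + v) - (a + u) - 2 * x) * ((1 - q) * v - q * u) -
          (q * u * u + (1 - q) * v * v) := by ring
    rw [h3, h2, hm]
    linarith

lemma exp_sub_one_le_mul_exp (y : ℝ) : Real.exp y - 1 ≤ y * Real.exp y := by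
  have h1 := Real.add_one_le_exp (-y)
  have h2 : Real.exp (-y) * Real.exp y = 1 := by rw [← Real.exp_add]; simp
  nlinarith [Real.exp_pos y]

/-- The linear function is damped near the lower barrier. Let `M(l)` be the mean of `exp (-l *
step)`, the quantity in `hM`. The subtracted term does not decrease on average, since its change is
a nonnegative combination of `M(l) - 1` and `M'(l)`; by convexity, `M(l) ≥ 1 = M(0)` forces `M'(l) ≥
0`. -/
lemma exitLyapunov_exp {q u v a b l : ℝ} (hm : 0 < (1 - q) * v - q * u) (hq : 0 ≤ q)
    (hq1 : q ≤ 1) (hl : 0 < l)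
    (hM : 1 ≤ q * Real.exp (l * u) + (1 - q) * Real.exp (-(l * v))) (hv : 0 < v) :
    IsExitLyapunov q u v a b (fun x => (b + v - x) * (1 - Real.exp (-(l * (x + (a + u))))))
      ((1 - q) * v - q * u) where
  measurable := by fun_prop
  pos := hm
  nonneg x h1 h2 := by
    refine mul_nonneg (by linarith) ?_
    have : Real.exp (-(l * (x + (a + u)))) ≤ 1 := by
      rw [Real.exp_le_one_iff]
      have := mul_nonneg hl.le (by linarith : 0 ≤ x + (a + u))
      linarith
    linarith
  drift x _ h2 := by
    set K := Real.exp (-(l * (x + (a + u)))) with hK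
    have hK0 : 0 < K := Real.exp_pos _
    have e1 : Real.exp (-(l * (x - u + (a + u)))) = K * Real.exp (l * u) := by
      rw [hK, ← Real.exp_add]; congr 1; ring
    have e2 : Real.exp (-(l * (x + v + (a + u)))) = K * Real.exp (-(l * v)) := by
      rw [hK, ← Real.exp_add]; congr 1; ring
    rw [e1, e2]
    set eu := Real.exp (l * u) with heu
    set ev := Real.exp (-(l * v)) with hev
    have h3 : 0 ≤ q * u * eu - (1 - q) * v * ev := by
      have h4 : eu - 1 ≤ l * u * eu := exp_sub_one_le_mul_exp _
      have h5 : ev - 1 ≤ -(l * v) * ev := exp_sub_one_le_mul_exp _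
      have h6 : 0 ≤ l * (q * u * eu - (1 - q) * v * ev) := by
        have := mul_le_mul_of_nonneg_left h4 hq
        have := mul_le_mul_of_nonneg_left h5 (by linarith : 0 ≤ 1 - q)
        nlinarith
      exact nonneg_of_mul_nonneg_right h6 hl
    have h7 : 0 ≤ (b + v - x) * K * (q * eu + (1 - q) * ev - 1) :=
      mul_nonneg (mul_nonneg (by linarith) hK0.le) (by linarith)
    have h8 : 0 ≤ K * (q * u * eu - (1 - q) * v * ev) := mul_nonneg hK0.le h3
    nlinarith

/-- The driftless probability of a down step is `r = v / (u + v)`, and `q = r * (1 - e)`. The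
exponent tilts `q` past `r`, to `q' = r * (1 + 2 * e)`; it remains to see that the up steps keep at
least the weight `1 - q'`. -/
lemma one_le_tilted {u v e : ℝ} (hu : 0 < u) (hv : 0 < v) (he : 0 < e) (he1 : e ≤ 1 / 4) {q : ℝ}
    (hq : q * (u + v) = v * (1 - e)) {l : ℝ} (hl : l * u = Real.log ((1 + 2 * e) / (1 - e))) :
    1 ≤ q * Real.exp (l * u) + (1 - q) * Real.exp (-(l * v)) := by
  set r := v / (u + v) with hr
  have huv : 0 < u + v := by linarith
  have hr0 : 0 < r := div_pos hv huv
  have hr1 : 0 < 1 - r := by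
    rw [hr, one_sub_div huv.ne']; simp; positivity
  have hvr : v * (1 - r) = u * r := by rw [hr]; field_simp; ring
  have hqr : q = r * (1 - e) := by
    rw [hr]; field_simp; linarith
  clear_value r
  have hy : 0 < (1 + 2 * e) / (1 - e) := div_pos (by linarith) (by linarith)
  have hq0 : 0 < q := by rw [hqr]; exact mul_pos hr0 (by linarith)
  have hq1 : q < 1 := by rw [hqr]; nlinarith
  rw [hl, Real.exp_log hy]
  have hq' : q * ((1 + 2 * e) / (1 - e)) = r * (1 + 2 * e) := by
    rw [hqr]; field_simp [show (1 - e) ≠ 0 by linarith]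
  rw [hq']
  rcases le_or_gt 1 (r * (1 + 2 * e)) with h | h
  · have : 0 ≤ (1 - q) * Real.exp (-(l * v)) := mul_nonneg (by linarith) (Real.exp_pos _).le
    linarith
  · set q' := r * (1 + 2 * e) with hq'def
    have hz : 0 < (1 - q) / (1 - q') := div_pos (by linarith) (by linarith)
    suffices hlv : l * v ≤ Real.log ((1 - q) / (1 - q')) by
      have h1 : Real.exp (l * v) ≤ (1 - q) / (1 - q') := by
        rw [← Real.exp_log hz]; exact Real.exp_le_exp.2 hlv
      rw [le_div_iff₀ (by linarith)] at h1
      have h2 : Real.exp (-(l * v)) * Real.exp (l * v) = 1 := by rw [← Real.exp_add]; simp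
      have h3 := Real.exp_pos (-(l * v))
      have h4 := mul_le_mul_of_nonneg_left h1 h3.le
      nlinarith
    have hqq' : q ≤ q' := by rw [hqr, hq'def]; nlinarith
    -- The bounds `log y ≤ (y - 1 / y) / 2` and `log (1 + x) ≥ 2 * x / (x + 2)` turn the claim into
    -- a polynomial inequality, where the factor 2 in `1 + 2 * e` leaves room of order `e` and `e ≤
    -- 1 / 4` controls the quadratic loss.
    have hlog1 : Real.log ((1 + 2 * e) / (1 - e)) ≤ (q' / q - q / q') / 2 := by
      have h1 : (1 + 2 * e) / (1 - e) = q' / q := by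
        rw [hqr, hq'def]; field_simp
      have h2 : 1 ≤ q' / q := by rw [le_div_iff₀ hq0]; linarith
      have h3 := Real.self_le_sinh_iff.2 (Real.log_nonneg h2)
      rw [Real.sinh_log (by positivity), inv_div] at h3
      rw [h1]; exact h3
    have hlog2 : 2 * (q' - q) / (2 - q - q') ≤ Real.log ((1 - q) / (1 - q')) := by
      have h1 := Real.le_log_one_add_of_nonneg
        (x := (q' - q) / (1 - q')) (div_nonneg (by linarith) (by linarith))
      have h2 : 1 + (q' - q) / (1 - q') = (1 - q) / (1 - q') := by
        field_simp [show 1 - q' ≠ 0 by linarith]; ring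
      rw [h2] at h1
      convert h1 using 1
      have h3 : (1 - q') ≠ 0 := by linarith
      have h4 : (2 - q - q') ≠ 0 := by linarith
      have h5 : (q' - q) / (1 - q') + 2 = (2 - q - q') / (1 - q') := by field_simp; ring
      rw [h5]
      field_simp
    have hq'0 : 0 < q' := by linarith
    have hlv : l * v * (1 - r) = r * Real.log ((1 + 2 * e) / (1 - e)) := by
      rw [← hl]; linear_combination l * hvr
    have h5 : r * ((q' / q - q / q') / 2) ≤ 2 * (q' - q) / (2 - q - q') * (1 - r) := by
      have h6 : (q' / q - q / q') / 2 = (q' - q) * (q' + q) / (2 * q * q') := by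
        field_simp; ring
      rw [h6, ← mul_div_assoc, div_mul_eq_mul_div, div_le_div_iff₀ (by positivity) (by linarith)]
      have h7 : r * (q' + q) * (2 - q - q') ≤ 4 * (1 - r) * (q * q') := by
        rw [hqr, hq'def]
        have h8 : 0 ≤ r ^ 2 * (2 * e + r * e ^ 2 - 8 * (1 - r) * e ^ 2) := by
          apply mul_nonneg (by positivity)
          nlinarith [mul_pos hr0 (mul_pos he he), mul_nonneg he.le (by linarith : 0 ≤ 1 / 4 - e)]
        nlinarith
      have h9 := mul_le_mul_of_nonneg_left h7 (by linarith : 0 ≤ q' - q)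
      nlinarith
    have h10 : l * v * (1 - r) ≤ Real.log ((1 - q) / (1 - q')) * (1 - r) := by
      rw [hlv]
      calc _ ≤ r * ((q' / q - q / q') / 2) := mul_le_mul_of_nonneg_left hlog1 hr0.le
        _ ≤ _ := h5
        _ ≤ _ := mul_le_mul_of_nonneg_right hlog2 hr1.le
    exact le_of_mul_le_mul_right h10 hr1

/-- No single function works for all drifts: the linear one gives a bound of order `1 / m`, useless
for a small drift `m`. The damped one has initial value of order `m`, which cancels this. -/
lemma exists_exitLyapunov_of_nonneg_drift {q u v a b : ℝ} (hq : 0 ≤ q) (hq1 : q ≤ 1) (hu : 0 < u)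
    (hv : 0 < v) (ha : 0 < a) (hb : 0 < b) (hm : 0 ≤ (1 - q) * v - q * u) :
    ∃ f c, IsExitLyapunov q u v a b f c ∧ f 0 ≤ c * (4 * ((1 + a / u) * (1 + b / v))) := by
  have hA : (1 + a / u) = (a + u) / u := by field_simp; ring
  have hB : (1 + b / v) = (b + v) / v := by field_simp; ring
  have hAB : (u * v) * ((1 + a / u) * (1 + b / v)) = (a + u) * (b + v) := by
    rw [hA, hB]; field_simp
  have hA1 : 1 ≤ 1 + a / u := by have := div_pos ha hu; linarith
  rcases hm.eq_or_lt with hm | hm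
  · refine ⟨_, _, exitLyapunov_quadratic hu hv (by linarith), ?_⟩
    have : 0 ≤ (a + u) * (b + v) := by positivity
    simp only [zero_add, sub_zero]
    nlinarith
  · set m := (1 - q) * v - q * u with hmdef
    -- With `e = m / v ≤ 1 / 4` one has `l * u ≤ 3 * e / (1 - e) ≤ 4 * e`, hence the constant 4;
    -- above the threshold, `v < 4 * m` serves directly.
    rcases le_or_gt m (v / 4) with h | h
    · set e := m / v with he
      have hev : e * v = m := by rw [he]; field_simp
      have he0 : 0 < e := div_pos hm hv
      have he1 : e ≤ 1 / 4 := by rw [he, div_le_iff₀ hv]; linarith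
      have hy : 1 < (1 + 2 * e) / (1 - e) := by rw [lt_div_iff₀ (by linarith)]; linarith
      set l := Real.log ((1 + 2 * e) / (1 - e)) / u with hl
      have hl0 : 0 < l := div_pos (Real.log_pos hy) hu
      have hlu : l * u = Real.log ((1 + 2 * e) / (1 - e)) := by rw [hl]; field_simp
      have hqe : q * (u + v) = v * (1 - e) := by
        rw [mul_sub, mul_one, mul_comm v e, hev, hmdef]; ring
      have hM := one_le_tilted hu hv he0 he1 hqe hlu
      refine ⟨_, _, exitLyapunov_exp (a := a) (b := b) hm hq hq1 hl0 hM hv, ?_⟩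
      have h1 : l * u ≤ 4 * e := by
        rw [hlu]
        refine (Real.log_le_sub_one_of_pos (by linarith)).trans ?_
        rw [sub_le_iff_le_add, div_le_iff₀ (by linarith)]
        nlinarith
      have h2 := Real.add_one_le_exp (-(l * (0 + (a + u))))
      have h3 : (b + v - 0) * (1 - Real.exp (-(l * (0 + (a + u))))) ≤ (b + v) * (l * (a + u)) := by
        rw [sub_zero]
        apply mul_le_mul_of_nonneg_left _ (by linarith)
        rw [zero_add] at h2 ⊢
        linarith
      refine h3.trans ?_
      have h4 : (b + v) * (l * (a + u)) = l * u * v * ((1 + a / u) * (1 + b / v)) := by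
        linear_combination (-l) * hAB
      have h5 : l * u * v ≤ m * 4 := by
        have := mul_le_mul_of_nonneg_right h1 hv.le
        linarith
      rw [h4, ← mul_assoc m]
      exact mul_le_mul_of_nonneg_right h5 (by positivity)
    · refine ⟨_, _, exitLyapunov_linear hm, ?_⟩
      have h1 : b + v = v * (1 + b / v) := by rw [hB]; field_simp
      rw [sub_zero, h1]
      have h2 : 0 < 1 + b / v := by positivity
      calc v * (1 + b / v) ≤ (m * 4) * (1 + b / v) :=
            mul_le_mul_of_nonneg_right (by linarith) h2.le
        _ ≤ (m * 4) * ((1 + a / u) * (1 + b / v)) := by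
            apply mul_le_mul_of_nonneg_left _ (by positivity)
            nlinarith
        _ = _ := by ring

lemma exists_exitLyapunov {q u v a b : ℝ} (hq : 0 ≤ q) (hq1 : q ≤ 1) (hu : 0 < u)
    (hv : 0 < v) (ha : 0 < a) (hb : 0 < b) :
    ∃ f c, IsExitLyapunov q u v a b f c ∧ f 0 ≤ c * (4 * ((1 + a / u) * (1 + b / v))) := by
  rcases le_total 0 ((1 - q) * v - q * u) with hm | hm
  · exact exists_exitLyapunov_of_nonneg_drift hq hq1 hu hv ha hb hm
  · obtain ⟨f, c, hf, h0⟩ := exists_exitLyapunov_of_nonneg_drift (q := 1 - q) (u := v) (v := u)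
      (a := b) (b := a) (by linarith) (by linarith) hv hu hb ha (by linarith)
    refine ⟨_, _, hf.symm, ?_⟩
    simp only [neg_zero]
    rw [mul_comm (1 + a / u)]
    exact h0

end Lyapunov

/-! ### The expected cost of the sequential probability ratio test -/

section SequentialTest

variable {Ω : Type*} {X : Ω → Prop} {θ₀ θ₁ α β : ℝ}

lemma logRatio_congr {ω ω' : ℕ → Ω} {n : ℕ} (h : ∀ i < n, ω i = ω' i) :
    logRatio θ₀ θ₁ X ω n = logRatio θ₀ θ₁ X ω' n := by
  unfold logRatio
  exact Finset.sum_congr rfl (fun i hi => by rw [h i (Finset.mem_range.1 hi)])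

/-- The test has not decided after any number `n ≤ j` of observations. -/
def undecided (θ₀ θ₁ α β : ℝ) (X : Ω → Prop) (j : ℕ) : Set (ℕ → Ω) :=
  {ω | ∀ n ≤ j, ¬ SPRTDecides θ₀ θ₁ α β X ω n}

lemma undecided_congr {ω ω' : ℕ → Ω} {j : ℕ} (h : ∀ i < j, ω i = ω' i) :
    ω ∈ undecided θ₀ θ₁ α β X j ↔ ω' ∈ undecided θ₀ θ₁ α β X j := by
  refine forall₂_congr (fun n hn => ?_)
  unfold SPRTDecides
  rw [logRatio_congr (fun i hi => h i (by omega))]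

variable [MeasurableSpace Ω]

/-- A function of the first `j` coordinates is independent of the coordinate `j`. -/
lemma lintegral_infinitePi_mul (ν : Measure Ω) [IsProbabilityMeasure ν] (j : ℕ)
    {F : (ℕ → Ω) → ℝ≥0∞} (hF : Measurable F) (hFj : ∀ ω ω', (∀ i < j, ω i = ω' i) → F ω = F ω')
    {G : Ω → ℝ≥0∞} (hG : Measurable G) :
    ∫⁻ ω, F ω * G (ω j) ∂(Measure.infinitePi (fun _ : ℕ => ν)) =
      (∫⁻ ω, F ω ∂(Measure.infinitePi (fun _ : ℕ => ν))) * ∫⁻ x, G x ∂ν := by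
  classical
  obtain ⟨x₀⟩ : Nonempty Ω := nonempty_of_isProbabilityMeasure ν
  have hind : iIndepFun (fun (i : ℕ) (ω : ℕ → Ω) => ω i) (Measure.infinitePi (fun _ : ℕ => ν)) :=
    iIndepFun_infinitePi (X := fun _ x => x) (fun _ => measurable_id)
  have h1 := hind.indepFun_finset (Finset.range j) {j} (by simp) (fun i => measurable_pi_apply i)
  -- Padding a finite tuple by the arbitrary point `x₀` exhibits `F` as a function of the first `j`
  -- coordinates.
  set ext : (Finset.range j → Ω) → (ℕ → Ω) :=
    fun y i => if hi : i ∈ Finset.range j then y ⟨i, hi⟩ else x₀ with hext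
  have hextm : Measurable ext := by
    refine measurable_pi_lambda _ (fun i => ?_)
    by_cases hi : i ∈ Finset.range j
    · simp only [hext, hi, dif_pos]; exact measurable_pi_apply _
    · simp only [hext, hi, dif_neg, not_false_eq_true]; exact measurable_const
  have hGj : Measurable (fun y : ({j} : Finset ℕ) → Ω => G (y ⟨j, by simp⟩)) :=
    hG.comp (measurable_pi_apply _)
  have h2 := h1.comp (hF.comp hextm) hGj
  have h3 : (F ∘ ext) ∘ (fun (ω : ℕ → Ω) (i : Finset.range j) => ω i) = F := by
    funext ω
    refine hFj _ _ (fun i hi => ?_)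
    simp [hext, hi]
  rw [h3] at h2
  change F ⟂ᵢ[_] (fun ω => G (ω j)) at h2
  have hGω : Measurable (fun ω : ℕ → Ω => G (ω j)) := hG.comp (measurable_pi_apply j)
  rw [lintegral_mul_eq_lintegral_mul_lintegral_of_indepFun'' hF.aemeasurable
    hGω.aemeasurable h2]
  congr 1
  rw [← (measurePreserving_eval_infinitePi (fun _ : ℕ => ν) j).lintegral_comp hG]

lemma measurable_logRatio (hX : MeasurableSet {x | X x}) (n : ℕ) :
    Measurable (fun ω => logRatio θ₀ θ₁ X ω n) := by
  classical
  unfold logRatio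
  refine Finset.measurable_sum _ (fun j _ => ?_)
  exact Measurable.ite (measurable_pi_apply j hX) measurable_const measurable_const

lemma measurableSet_undecided (hX : MeasurableSet {x | X x}) (j : ℕ) :
    MeasurableSet (undecided θ₀ θ₁ α β X j) := by
  simp only [undecided, SPRTDecides, not_or, not_le, Set.ofPred_forall]
  refine MeasurableSet.iInter (fun n => MeasurableSet.iInter (fun _ => ?_))
  have hm := measurable_logRatio (θ₀ := θ₀) (θ₁ := θ₁) hX n
  exact (measurableSet_lt measurable_const hm).inter (measurableSet_lt hm measurable_const)

/-- Wald's identity: the decision to draw simulation `j` is made from the previous outcomes, hence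
is independent of its cost. -/
lemma sprtTime_eq (ν : Measure Ω) [IsProbabilityMeasure ν] (hX : MeasurableSet {x | X x})
    {c : Ω → ℝ≥0∞} (hc : Measurable c) :
    sprtTime ν X c θ₀ θ₁ α β = (∑' j : ℕ, (Measure.infinitePi (fun _ : ℕ => ν))
      (undecided θ₀ θ₁ α β X j)) * ∫⁻ x, c x ∂ν := by
  classical
  have hD := measurableSet_undecided (θ₀ := θ₀) (θ₁ := θ₁) (α := α) (β := β) hX
  unfold sprtTime
  rw [lintegral_tsum, ← ENNReal.tsum_mul_right]
  · refine tsum_congr (fun j => ?_)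
    rw [← lintegral_indicator_one (hD j), ← lintegral_infinitePi_mul ν j
      (measurable_one.indicator (hD j)) _ hc]
    · refine lintegral_congr (fun ω => ?_)
      by_cases h : ω ∈ undecided θ₀ θ₁ α β X j
      · rw [Set.indicator_of_mem h, if_pos (show ∀ n ≤ j, _ from h)]; simp
      · rw [Set.indicator_of_notMem h, if_neg (show ¬ ∀ n ≤ j, _ from h)]; simp
    · intro ω ω' h
      have := undecided_congr (θ₀ := θ₀) (θ₁ := θ₁) (α := α) (β := β) (X := X) h
      by_cases h' : ω ∈ undecided θ₀ θ₁ α β X j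
      · rw [Set.indicator_of_mem h', Set.indicator_of_mem (this.1 h')]; rfl
      · rw [Set.indicator_of_notMem h', Set.indicator_of_notMem (fun h => h' (this.2 h))]
  · intro j
    exact (Measurable.ite (hD j) (hc.comp (measurable_pi_apply j)) measurable_const).aemeasurable

/-- The expected number of observations of the test is bounded by means of a Lyapunov function. -/
lemma tsum_undecided_le (ν : Measure Ω) [IsProbabilityMeasure ν] (hX : MeasurableSet {x | X x})
    {u v a b : ℝ} (hu : Real.log (θ₁ / θ₀) = -u) (hv : Real.log ((1 - θ₁) / (1 - θ₀)) = v)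
    (ha : Real.log (β / (1 - α)) = -a) (hb : Real.log ((1 - β) / α) = b)
    (hu0 : 0 < u) (hv0 : 0 < v)
    {f : ℝ → ℝ} {c : ℝ} (hf : IsExitLyapunov (ν.real {x | X x}) u v a b f c) :
    ∑' j : ℕ, (Measure.infinitePi (fun _ : ℕ => ν)) (undecided θ₀ θ₁ α β X j) ≤
      ENNReal.ofReal (f 0 / c) := by
  classical
  set P := Measure.infinitePi (fun _ : ℕ => ν) with hP
  set D : ℕ → Set (ℕ → Ω) := undecided θ₀ θ₁ α β X with hDdef
  have hD : ∀ j, MeasurableSet (D j) := measurableSet_undecided hX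
  set W : ℕ → (ℕ → Ω) → ℝ := fun n ω => logRatio θ₀ θ₁ X ω n with hW
  have hWm : ∀ n, Measurable (W n) := measurable_logRatio hX
  set g : ℝ → ℝ≥0∞ := fun x => ENNReal.ofReal (f x) with hg
  have hgm : Measurable g := hf.measurable.ennreal_ofReal
  have hin : ∀ j ω, ω ∈ D j → -a < W j ω ∧ W j ω < b := by
    intro j ω h
    have := h j le_rfl
    simp only [SPRTDecides, not_or, not_le, ha, hb] at this
    exact this
  have hstep : ∀ j ω, W (j + 1) ω = if X (ω j) then W j ω - u else W j ω + v := by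
    intro j ω
    simp only [hW, logRatio, Finset.sum_range_succ, hu, hv]
    split_ifs <;> ring
  -- The mean of the Lyapunov function over the undecided runs. One observation lowers it by at
  -- least `c` times the probability of being undecided, and these losses telescope.
  set I : ℕ → ℝ≥0∞ := fun j => ∫⁻ ω, (D j).indicator 1 ω * g (W j ω) ∂P with hI
  have hdep : ∀ (h : ℝ → ℝ≥0∞) j (ω ω' : ℕ → Ω), (∀ i < j, ω i = ω' i) →
      (D j).indicator (1 : (ℕ → Ω) → ℝ≥0∞) ω * h (W j ω) =
        (D j).indicator (1 : (ℕ → Ω) → ℝ≥0∞) ω' * h (W j ω') := by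
    intro h j ω ω' hω
    have h1 : W j ω = W j ω' := logRatio_congr hω
    have h2 : ω ∈ D j ↔ ω' ∈ D j := undecided_congr hω
    rw [h1]
    by_cases h3 : ω ∈ D j
    · rw [Set.indicator_of_mem h3, Set.indicator_of_mem (h2.1 h3)]; rfl
    · rw [Set.indicator_of_notMem h3, Set.indicator_of_notMem (fun h => h3 (h2.2 h))]
  have hmeas : ∀ (h : ℝ → ℝ≥0∞), Measurable h → ∀ j,
      Measurable (fun ω => (D j).indicator (1 : (ℕ → Ω) → ℝ≥0∞) ω * h (W j ω)) :=
    fun h hh j => (measurable_one.indicator (hD j)).mul (hh.comp (hWm j))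
  set Y : Set Ω := {x | X x} with hY
  have hrec : ∀ j, I (j + 1) + ENNReal.ofReal c * P (D j) ≤ I j := by
    intro j
    have h1 : I (j + 1) ≤ ∫⁻ ω, ((D j).indicator 1 ω * g (W j ω - u)) * Y.indicator 1 (ω j) +
        ((D j).indicator 1 ω * g (W j ω + v)) * Yᶜ.indicator 1 (ω j) ∂P := by
      refine lintegral_mono (fun ω => ?_)
      simp only
      by_cases h : ω ∈ D (j + 1)
      · have h' : ω ∈ D j := fun n hn => h n (by omega)
        rw [Set.indicator_of_mem h, Set.indicator_of_mem h', hstep]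
        by_cases hx : X (ω j)
        · rw [if_pos hx, Set.indicator_of_mem (show ω j ∈ Y from hx)]; simp
        · rw [if_neg hx, Set.indicator_of_mem (show ω j ∈ Yᶜ from hx)]; simp
      · rw [Set.indicator_of_notMem h]; simp
    have hmu := hmeas (fun x => g (x - u)) (hgm.comp (measurable_id.sub_const u)) j
    have hmv := hmeas (fun x => g (x + v)) (hgm.comp (measurable_id.add_const v)) j
    have hYm : Measurable (Y.indicator (1 : Ω → ℝ≥0∞)) := measurable_one.indicator hX
    have hYm' : Measurable (Yᶜ.indicator (1 : Ω → ℝ≥0∞)) := measurable_one.indicator hX.compl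
    have hmY : Measurable (fun ω : ℕ → Ω =>
        ((D j).indicator 1 ω * g (W j ω - u)) * Y.indicator 1 (ω j)) :=
      hmu.mul (hYm.comp (measurable_pi_apply j))
    rw [lintegral_add_left hmY,
      lintegral_infinitePi_mul ν j hmu (hdep (fun x => g (x - u)) j) hYm,
      lintegral_infinitePi_mul ν j hmv (hdep (fun x => g (x + v)) j) hYm',
      lintegral_indicator_one hX, lintegral_indicator_one hX.compl] at h1
    refine (add_le_add_left h1 _).trans ?_
    have hmS : Measurable (fun ω : ℕ → Ω => (D j).indicator 1 ω * g (W j ω - u) * ν Y +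
        (D j).indicator 1 ω * g (W j ω + v) * ν Yᶜ) :=
      (hmu.mul_const _).add (hmv.mul_const _)
    rw [← lintegral_indicator_one (hD j), ← lintegral_mul_const _ hmu, ← lintegral_mul_const _ hmv,
      ← lintegral_const_mul _ (measurable_one.indicator (hD j)),
      ← lintegral_add_left (hmu.mul_const _),
      ← hP, ← lintegral_add_left hmS]
    refine lintegral_mono (fun ω => ?_)
    simp only
    by_cases h : ω ∈ D j
    · obtain ⟨h2, h3⟩ := hin j ω h
      rw [Set.indicator_of_mem h]
      simp only [Pi.one_apply, one_mul, mul_one, hg]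
      have hνY : ν Y = ENNReal.ofReal (ν.real Y) := by simp [Measure.real]
      have hνYc : ν Yᶜ = ENNReal.ofReal (1 - ν.real Y) := by
        rw [← probReal_compl_eq_one_sub hX]; simp [Measure.real]
      have hf1 : 0 ≤ f (W j ω - u) := hf.nonneg _ (by linarith) (by linarith)
      have hf2 : 0 ≤ f (W j ω + v) := hf.nonneg _ (by linarith) (by linarith)
      have hq1 : ν.real Y ≤ 1 := measureReal_le_one
      have hq0 : 0 ≤ ν.real Y := measureReal_nonneg
      rw [hνY, hνYc, ← ENNReal.ofReal_mul hf1, ← ENNReal.ofReal_mul hf2,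
        ← ENNReal.ofReal_add (by positivity) (mul_nonneg hf2 (by linarith)),
        ← ENNReal.ofReal_add (add_nonneg (by positivity) (mul_nonneg hf2 (by linarith)))
          hf.pos.le]
      apply ENNReal.ofReal_le_ofReal
      have := hf.drift _ h2 h3
      linarith
    · rw [Set.indicator_of_notMem h]; simp
  have hsum : ∀ n, I n + ENNReal.ofReal c * ∑ j ∈ Finset.range n, P (D j) ≤ I 0 := by
    intro n
    induction n with
    | zero => simp
    | succ n ih =>
      refine le_trans ?_ ih
      rw [Finset.sum_range_succ, mul_add, add_comm (ENNReal.ofReal c * _), ← add_assoc]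
      exact add_le_add_left (hrec n) _
  have hI0 : I 0 ≤ ENNReal.ofReal (f 0) := by
    calc I 0 ≤ ∫⁻ _, ENNReal.ofReal (f 0) ∂P := by
          refine lintegral_mono (fun ω => ?_)
          have : W 0 ω = 0 := by simp [hW, logRatio]
          simp only [this, hg]
          by_cases h : ω ∈ D 0
          · rw [Set.indicator_of_mem h]; simp
          · rw [Set.indicator_of_notMem h]; simp
      _ = _ := by simp
  have hc0 : ENNReal.ofReal c ≠ 0 := by simpa using hf.pos
  apply ENNReal.tsum_le_of_sum_range_le
  intro n
  rw [ENNReal.ofReal_div_of_pos hf.pos, ENNReal.le_div_iff_mul_le (Or.inl hc0)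
    (Or.inl ENNReal.ofReal_ne_top), mul_comm]
  exact (le_add_self.trans (hsum n)).trans hI0

/-- The expected cost of the test is at most a constant times the expected cost of a simulation
times the a priori bound on their number, whatever the probability of the answer Yes. -/
lemma sprtTime_le (ν : Measure Ω) [IsProbabilityMeasure ν] (hX : MeasurableSet {x | X x})
    {c : Ω → ℝ≥0∞} (hc : Measurable c) {p ε δ κ : ℝ} (hε : 0 < ε) (hδ : δ = ε / 2)
    (h0 : 0 < p - ε + δ) (h1 : p + ε - δ < 1) (hα : 0 < α) (hβ : 0 < β) (hαβ : α + β < 1)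
    (hκ : 0 < κ)
    (hκa : κ * Real.log ((p + ε - δ) / (p - ε + δ)) ≤ Real.log ((1 - α) / β))
    (hκb : κ * Real.log ((1 - p + ε - δ) / (1 - p - ε + δ)) ≤ Real.log ((1 - β) / α))
    (hθ : 0 < θ₁) (hθ1 : θ₁ ≤ p - ε + δ) :
    sprtTime ν X c (p + ε - δ) θ₁ α β ≤
      ENNReal.ofReal (4 * (1 + 1 / κ) ^ 2 * sim p ε δ α β) * ∫⁻ x, c x ∂ν := by
  rw [sprtTime_eq ν hX hc]
  gcongr
  set u := Real.log ((p + ε - δ) / θ₁) with hu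
  set v := Real.log ((1 - θ₁) / (1 - (p + ε - δ))) with hv
  set a := Real.log ((1 - α) / β) with ha
  set b := Real.log ((1 - β) / α) with hb
  set u' := Real.log ((p + ε - δ) / (p - ε + δ)) with hu'
  set v' := Real.log ((1 - p + ε - δ) / (1 - p - ε + δ)) with hv'
  have hp : 0 < p + ε - δ := by linarith
  have hq : 0 < 1 - p - ε + δ := by linarith
  have hu'0 : 0 < u' := Real.log_pos (by rw [lt_div_iff₀ h0]; linarith)
  have hv'0 : 0 < v' := Real.log_pos (by rw [lt_div_iff₀ hq]; linarith)
  have huu' : u' ≤ u := Real.log_le_log (by positivity) (by gcongr)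
  have hvv' : v' ≤ v := by
    apply Real.log_le_log (div_pos (by linarith) hq)
    rw [show 1 - (p + ε - δ) = 1 - p - ε + δ by ring]
    exact div_le_div_of_nonneg_right (by linarith) hq.le
  have ha0 : 0 < a := Real.log_pos (by rw [lt_div_iff₀ hβ]; linarith)
  have hb0 : 0 < b := Real.log_pos (by rw [lt_div_iff₀ hα]; linarith)
  have hu0 : 0 < u := hu'0.trans_le huu'
  have hv0 : 0 < v := hv'0.trans_le hvv'
  obtain ⟨f, d, hf, hfd⟩ := exists_exitLyapunov (q := ν.real {x | X x}) measureReal_nonneg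
    measureReal_le_one hu0 hv0 ha0 hb0
  refine (tsum_undecided_le ν hX (u := u) (v := v) (a := a) (b := b) ?_ rfl ?_ rfl hu0 hv0 hf).trans ?_
  · rw [hu, ← Real.log_inv, inv_div]
  · rw [ha, ← Real.log_inv, inv_div]
  apply ENNReal.ofReal_le_ofReal
  rw [div_le_iff₀ hf.pos]
  refine hfd.trans ?_
  rw [mul_comm]
  apply mul_le_mul_of_nonneg_right _ hf.pos.le
  have hsim : sim p ε δ α β = (a / u') * (b / v') := by
    have e1 : Real.log (β / (1 - α)) = -a := by rw [ha, ← Real.log_inv, inv_div]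
    have e2 : Real.log ((p - ε + δ) / (p + ε - δ)) = -u' := by rw [hu', ← Real.log_inv, inv_div]
    have e3 : Real.log ((1 - p - ε + δ) / (1 - p + ε - δ)) = -v' := by
      rw [hv', ← Real.log_inv, inv_div]
    rw [sim, e1, e2, e3, ← hb]
    field_simp
  rw [hsim]
  -- A smaller `θ₁` only lengthens the steps, so `a / u ≤ a / u'`; the condition with `κ` bounds the
  -- summand 1, which accounts for the overshoot.
  have hA : 1 + a / u ≤ (1 + 1 / κ) * (a / u') := by
    have h2 : a / u ≤ a / u' := by gcongr
    have h3 : 1 ≤ 1 / κ * (a / u') := by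
      rw [div_mul_div_comm, one_mul, le_div_iff₀ (by positivity), one_mul]; exact hκa
    linarith
  have hB : 1 + b / v ≤ (1 + 1 / κ) * (b / v') := by
    have h2 : b / v ≤ b / v' := by gcongr
    have h3 : 1 ≤ 1 / κ * (b / v') := by
      rw [div_mul_div_comm, one_mul, le_div_iff₀ (by positivity), one_mul]; exact hκb
    linarith
  have := mul_le_mul hA hB (by positivity) (by positivity)
  calc 4 * ((1 + a / u) * (1 + b / v))
      ≤ 4 * ((1 + 1 / κ) * (a / u') * ((1 + 1 / κ) * (b / v'))) := by linarith
    _ = _ := by ring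

end SequentialTest

/-! ### The law of the runs of a Markov chain -/

section Runs

variable {S : Type*}

/-- Membership in `E` depends only on the first `n + 1` terms of the sequence. -/
def PrefixDetermined (n : ℕ) (E : Set (ℕ → S)) : Prop :=
  ∀ ρ ρ' : ℕ → S, (∀ i ≤ n, ρ i = ρ' i) → ρ ∈ E → ρ' ∈ E

/-- The sequences that agree with `x` up to the index `n`. -/
def prefixCylinder (x : ℕ → S) (n : ℕ) : Set (ℕ → S) := {ρ | ∀ i ≤ n, ρ i = x i}

/-- The sequence without its first `n` terms. -/
def shiftSeq (n : ℕ) (ρ : ℕ → S) : ℕ → S := fun i => ρ (n + i)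


lemma PrefixDetermined.mono {m n : ℕ} (h : m ≤ n) {E : Set (ℕ → S)} (hE : PrefixDetermined m E) :
    PrefixDetermined n E :=
  fun ρ ρ' hρ hm => hE ρ ρ' (fun i hi => hρ i (hi.trans h)) hm

lemma PrefixDetermined.inter {n : ℕ} {E F : Set (ℕ → S)} (hE : PrefixDetermined n E)
    (hF : PrefixDetermined n F) : PrefixDetermined n (E ∩ F) :=
  fun ρ ρ' h hm => ⟨hE ρ ρ' h hm.1, hF ρ ρ' h hm.2⟩

lemma prefixDetermined_eval {n m : ℕ} (h : m ≤ n) (A : Set S) :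
    PrefixDetermined n {ρ : ℕ → S | ρ m ∈ A} := by
  intro ρ ρ' hρ hm
  simpa [← hρ m h] using hm

lemma prefixDetermined_univ (n : ℕ) : PrefixDetermined n (Set.univ : Set (ℕ → S)) :=
  fun _ _ _ _ => trivial

lemma prefixDetermined_shift_prefixCylinder (n m : ℕ) (y : ℕ → S) :
    PrefixDetermined (n + m) (shiftSeq n ⁻¹' prefixCylinder y m) := by
  intro ρ ρ' h hm i hi
  rw [← hm i hi]
  exact (h (n + i) (by omega)).symm

lemma prefixDetermined_prefixCylinder (x : ℕ → S) (n : ℕ) :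
    PrefixDetermined n (prefixCylinder x n) := by
  intro ρ ρ' h hx i hi
  rw [← hx i hi, h i hi]

lemma prefixCylinder_succ (x : ℕ → S) (n : ℕ) :
    prefixCylinder x (n + 1) = prefixCylinder x n ∩ {ρ | ρ (n + 1) = x (n + 1)} := by
  ext ρ
  constructor
  · exact fun h => ⟨fun i hi => h i (by omega), h _ le_rfl⟩
  · rintro ⟨h, h'⟩ i hi
    rcases Nat.lt_or_ge i (n + 1) with hlt | hge
    · exact h i (by omega)
    · obtain rfl : i = n + 1 := by omega
      exact h'

/-- Moves such an event to a finite product of finite spaces, where every set is measurable. -/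
lemma PrefixDetermined.eq_preimage {n : ℕ} {E : Set (ℕ → S)} (hE : PrefixDetermined n E) :
    E = Preorder.frestrictLe (π := fun _ => S) n ⁻¹'
      (Preorder.frestrictLe (π := fun _ => S) n '' E) := by
  apply Set.Subset.antisymm (Set.subset_preimage_image _ _)
  rintro ρ ⟨ρ', hρ', h⟩
  refine hE ρ' ρ (fun i hi => ?_) hρ'
  exact congrFun h ⟨i, by simpa using hi⟩

variable [MeasurableSpace S]

lemma measurable_shiftSeq (n : ℕ) : Measurable (shiftSeq n : (ℕ → S) → ℕ → S) := by
  unfold shiftSeq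
  exact measurable_pi_lambda _ (fun i => measurable_pi_apply (n + i))

variable [Fintype S] [MeasurableSingletonClass S]

lemma PrefixDetermined.measurableSet {n : ℕ} {E : Set (ℕ → S)} (hE : PrefixDetermined n E) :
    MeasurableSet E := by
  rw [hE.eq_preimage]
  exact (Preorder.measurable_frestrictLe n) (Set.toFinite _).measurableSet

/-- Cylinders give the marginals on initial segments, these give all finite marginals, and
projective limits are unique. -/
lemma measure_ext_of_prefixCylinder {μ ν : Measure (ℕ → S)} [IsFiniteMeasure μ]
    (h : ∀ x n, μ (prefixCylinder x n) = ν (prefixCylinder x n)) : μ = ν := by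
  classical
  have key : ∀ n, μ.map (Preorder.frestrictLe n) = ν.map (Preorder.frestrictLe n) := by
    intro n
    apply Measure.ext_of_singleton
    intro a
    rw [Measure.map_apply (Preorder.measurable_frestrictLe n) (measurableSet_singleton _),
      Measure.map_apply (Preorder.measurable_frestrictLe n) (measurableSet_singleton _)]
    -- The values beyond `n` are irrelevant; `a` at 0 serves as a default.
    have : Preorder.frestrictLe (π := fun _ => S) n ⁻¹' {a} =
        prefixCylinder (fun i => if hi : i ≤ n then a ⟨i, by simpa using hi⟩
          else a ⟨0, by simp⟩) n := by
      ext ρ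
      simp only [Set.mem_preimage, Set.mem_singleton_iff, prefixCylinder, Set.mem_ofPred_eq]
      constructor
      · rintro rfl i hi
        simp [hi]
      · intro hρ
        ext ⟨i, hi⟩
        have hi' : i ≤ n := by simpa using hi
        simpa [hi'] using hρ i hi'
    rw [this, h]
  have hproj : ∀ I : Finset ℕ, ν.map I.restrict = μ.map I.restrict := by
    intro I
    have hsub : I ⊆ Finset.Iic (I.sup id) := I.subset_Iic_sup_id
    rw [← Finset.restrict₂_comp_restrict hsub, ← Measure.map_map (by fun_prop) (by fun_prop),
      ← Measure.map_map (by fun_prop) (by fun_prop)]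
    exact congrArg _ (key _).symm
  have h1 : IsProjectiveLimit μ (fun I => μ.map I.restrict) := fun I => rfl
  exact h1.unique hproj

end Runs

/-! ### Initial law, Markov property and uniqueness. -/

namespace MarkovChain

variable {S : Type*} [Fintype S] [MeasurableSpace S] [MeasurableSingletonClass S]

lemma runMeasure_zero (M : MarkovChain S) (s : S) : M.runMeasure {ρ | ρ 0 = s} = M.start s := by
  have hm : M.runMeasure.map (Preorder.frestrictLe 0) =
      M.start.toMeasure.map (MeasurableEquiv.piUnique (fun _ : Finset.Iic 0 => S)).symm := by
    unfold runMeasure Kernel.trajMeasure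
    rw [Measure.map_comp _ _ (by fun_prop), Kernel.traj_map_frestrictLe]
    simp
  have : {ρ : ℕ → S | ρ 0 = s} = Preorder.frestrictLe (π := fun _ => S) 0 ⁻¹'
      {a | a ⟨0, by simp⟩ = s} := by
    ext ρ; simp
  rw [this, ← Measure.map_apply (Preorder.measurable_frestrictLe 0)
    (Set.toFinite _).measurableSet, hm, Measure.map_apply (by fun_prop)
    (Set.toFinite _).measurableSet]
  have h2 : (MeasurableEquiv.piUnique (fun _ : Finset.Iic 0 => S)).symm ⁻¹'
      {a | a ⟨0, by simp⟩ = s} = {s} := by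
    ext t
    simp [MeasurableEquiv.piUnique, Equiv.piUnique]
  rw [h2, PMF.toMeasure_apply_singleton _ _ (measurableSet_singleton _)]

lemma runMeasure_succ (M : MarkovChain S) {n : ℕ} {E : Set (ℕ → S)} (hE : PrefixDetermined n E)
    (s s' : S) :
    M.runMeasure (E ∩ {ρ | ρ n = s} ∩ {ρ | ρ (n + 1) = s'}) =
      M.runMeasure (E ∩ {ρ | ρ n = s}) * M.step s s' := by
  have key := Kernel.map_frestrictLe_trajMeasure_compProd_eq_map_trajMeasure
    (X := fun _ => S) (μ₀ := M.start.toMeasure)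
    (κ := fun n => M.kernel.comap (fun h => h ⟨n, by simp⟩) (measurable_pi_apply _)) (a := n)
  change M.runMeasure.map (Preorder.frestrictLe n) ⊗ₘ _ = M.runMeasure.map _ at key
  have hE' : PrefixDetermined n (E ∩ {ρ | ρ n = s}) :=
    hE.inter (prefixDetermined_eval le_rfl {s})
  set F := Preorder.frestrictLe (π := fun _ => S) n '' (E ∩ {ρ | ρ n = s}) with hF
  have hFs : ∀ a ∈ F, a ⟨n, by simp⟩ = s := by
    rintro a ⟨ρ, hρ, rfl⟩
    exact hρ.2
  have hFm : MeasurableSet F := (Set.toFinite _).measurableSet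
  have h1 := DFunLike.congr_fun key (F ×ˢ {s'})
  rw [Measure.compProd_apply_prod hFm (measurableSet_singleton _), Measure.map_apply
    ((Preorder.measurable_frestrictLe n).prodMk (measurable_pi_apply _))
    (hFm.prod (measurableSet_singleton _))] at h1
  rw [setLIntegral_congr_fun (g := fun _ => M.step s s') hFm] at h1
  · rw [setLIntegral_const, Measure.map_apply (Preorder.measurable_frestrictLe n) hFm,
      ← hE'.eq_preimage] at h1
    rw [mul_comm, h1]
    congr 1
    ext ρ
    have : Preorder.frestrictLe (π := fun _ => S) n ρ ∈ F ↔ ρ ∈ E ∩ {ρ | ρ n = s} := by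
      conv_rhs => rw [hE'.eq_preimage]
      rfl
    constructor
    · rintro ⟨h, h'⟩; exact ⟨this.2 h, h'⟩
    · rintro ⟨h, h'⟩; exact ⟨this.1 h, h'⟩
  · intro a ha
    simp only [Kernel.comap_apply, kernel, Kernel.coe_mk, hFs a ha]
    exact PMF.toMeasure_apply_singleton _ _ (measurableSet_singleton _)

lemma startAt_runMeasure_zero (M : MarkovChain S) (s : S) :
    ∀ᵐ ρ ∂(M.startAt s).runMeasure, ρ 0 = s := by
  rw [ae_iff_measure_eq]
  · rw [runMeasure_zero]; simp [startAt]
  · exact (prefixDetermined_eval (n := 0) le_rfl {s}).measurableSet.nullMeasurableSet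

/-- The Markov property on cylinders. Extending the cylinder by one letter multiplies both sides by
the same transition probability. -/
lemma runMeasure_inter_shift_prefixCylinder (M : MarkovChain S) {n : ℕ} {E : Set (ℕ → S)}
    (hE : PrefixDetermined n E) (s : S) (y : ℕ → S) (m : ℕ) :
    M.runMeasure (E ∩ {ρ | ρ n = s} ∩ shiftSeq n ⁻¹' prefixCylinder y m) =
      M.runMeasure (E ∩ {ρ | ρ n = s}) * (M.startAt s).runMeasure (prefixCylinder y m) := by
  classical
  induction m with
  | zero =>
    have h1 : prefixCylinder y 0 = {ρ : ℕ → S | ρ 0 = y 0} := by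
      ext ρ; simp [prefixCylinder]
    have h2 : (shiftSeq n ⁻¹' {ρ : ℕ → S | ρ 0 = y 0}) = {ρ | ρ n = y 0} := by
      ext ρ; simp [shiftSeq]
    rw [h1, h2, runMeasure_zero (M.startAt s)]
    by_cases hs : y 0 = s
    · rw [hs, Set.inter_assoc, Set.inter_self]; simp [startAt]
    · have : E ∩ {ρ | ρ n = s} ∩ {ρ | ρ n = y 0} = ∅ := by
        ext ρ
        simp only [Set.mem_inter_iff, Set.mem_ofPred_eq, Set.mem_empty_iff_false, iff_false]
        rintro ⟨⟨_, h⟩, h'⟩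
        exact hs (h'.symm.trans h)
      rw [this]
      simp [startAt, hs]
  | succ m ih =>
    have hE1 : PrefixDetermined (n + m)
        (E ∩ {ρ | ρ n = s} ∩ shiftSeq n ⁻¹' prefixCylinder y m) :=
      ((hE.inter (prefixDetermined_eval le_rfl {s})).mono (by omega)).inter
        (prefixDetermined_shift_prefixCylinder n m y)
    have h1 : E ∩ {ρ | ρ n = s} ∩ shiftSeq n ⁻¹' prefixCylinder y m ∩ {ρ | ρ (n + m) = y m} =
        E ∩ {ρ | ρ n = s} ∩ shiftSeq n ⁻¹' prefixCylinder y m :=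
      Set.inter_eq_left.2 (fun ρ hρ => hρ.2 m le_rfl)
    have h2 : E ∩ {ρ | ρ n = s} ∩ shiftSeq n ⁻¹' prefixCylinder y (m + 1) =
        E ∩ {ρ | ρ n = s} ∩ shiftSeq n ⁻¹' prefixCylinder y m ∩ {ρ | ρ (n + m) = y m} ∩
          {ρ | ρ (n + m + 1) = y (m + 1)} := by
      rw [h1, prefixCylinder_succ, Set.preimage_inter, ← Set.inter_assoc]
      rfl
    have h4 : prefixCylinder y m ∩ {ρ | ρ m = y m} = prefixCylinder y m :=
      Set.inter_eq_left.2 (fun ρ hρ => hρ m le_rfl)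
    have h3 : prefixCylinder y (m + 1) = prefixCylinder y m ∩ {ρ | ρ m = y m} ∩
        {ρ | ρ (m + 1) = y (m + 1)} := by
      rw [h4, prefixCylinder_succ]
    have hc : PrefixDetermined m (prefixCylinder y m) := prefixDetermined_prefixCylinder y m
    rw [h2, runMeasure_succ M hE1, h1, ih, h3, runMeasure_succ _ hc, h4, mul_assoc]
    rfl

/-- The Markov property at the time `n`. -/
lemma lintegral_shiftSeq (M : MarkovChain S) {n : ℕ} {E : Set (ℕ → S)}
    (hE : PrefixDetermined n E) (s : S) {f : (ℕ → S) → ℝ≥0∞} (hf : Measurable f) :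
    ∫⁻ ρ in E ∩ {ρ | ρ n = s}, f (shiftSeq n ρ) ∂M.runMeasure =
      M.runMeasure (E ∩ {ρ | ρ n = s}) * ∫⁻ ρ, f ρ ∂(M.startAt s).runMeasure := by
  have hmE : MeasurableSet (E ∩ {ρ | ρ n = s}) :=
    (hE.inter (prefixDetermined_eval le_rfl {s})).measurableSet
  have key : (M.runMeasure.restrict (E ∩ {ρ | ρ n = s})).map (shiftSeq n) =
      M.runMeasure (E ∩ {ρ | ρ n = s}) • (M.startAt s).runMeasure := by
    apply measure_ext_of_prefixCylinder
    intro y m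
    have hc : MeasurableSet (prefixCylinder y m) :=
      (prefixDetermined_prefixCylinder y m).measurableSet
    rw [Measure.map_apply (measurable_shiftSeq n) hc,
      Measure.restrict_apply (measurable_shiftSeq n hc), Set.inter_comm,
      runMeasure_inter_shift_prefixCylinder M hE]
    rfl
  rw [← lintegral_map hf (measurable_shiftSeq n), key, lintegral_smul_measure]
  rfl

/-- The runs follow the edges of the chain. -/
lemma ae_edge (M : MarkovChain S) : ∀ᵐ ρ ∂M.runMeasure, ∀ n, M.edge (ρ n) (ρ (n + 1)) := by
  rw [ae_all_iff]
  intro n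
  have : ∀ s s' : S, ¬ M.edge s s' → ∀ᵐ ρ ∂M.runMeasure, ¬ (ρ n = s ∧ ρ (n + 1) = s') := by
    intro s s' h
    have h0 : M.step s s' = 0 := by
      by_contra h0
      exact h (ENNReal.toReal_pos h0 (PMF.apply_ne_top _ _))
    rw [ae_iff]
    have := runMeasure_succ M (prefixDetermined_univ n) s s'
    rw [h0, mul_zero, Set.univ_inter] at this
    simpa [Set.inter_def] using this
  have h2 : ∀ᵐ ρ ∂M.runMeasure, ∀ s s' : S, ¬ M.edge s s' → ¬ (ρ n = s ∧ ρ (n + 1) = s') := by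
    rw [ae_all_iff]; intro s
    rw [ae_all_iff]; intro s'
    by_cases h : M.edge s s'
    · simp [h]
    · filter_upwards [this s s' h] with ρ hρ _ using hρ
  filter_upwards [h2] with ρ hρ
  by_contra h
  exact hρ _ _ h ⟨rfl, rfl⟩

/-- The law of the runs is determined by the start and the steps. -/
lemma runMeasure_unique (M : MarkovChain S) (μ : Measure (ℕ → S)) [IsFiniteMeasure μ]
    (h0 : ∀ x : ℕ → S, μ (prefixCylinder x 0) = M.start (x 0))
    (h1 : ∀ (x : ℕ → S) n,
      μ (prefixCylinder x (n + 1)) = μ (prefixCylinder x n) * M.step (x n) (x (n + 1))) :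
    μ = M.runMeasure := by
  apply measure_ext_of_prefixCylinder
  intro x n
  induction n with
  | zero =>
    rw [h0, ← runMeasure_zero]
    congr 1
    ext ρ; simp [prefixCylinder]
  | succ n ih =>
    have hc : PrefixDetermined n (prefixCylinder x n) := prefixDetermined_prefixCylinder x n
    have h4 : prefixCylinder x n ∩ {ρ | ρ n = x n} = prefixCylinder x n :=
      Set.inter_eq_left.2 (fun ρ hρ => hρ n le_rfl)
    have := runMeasure_succ M hc (x n) (x (n + 1))
    rw [h4] at this
    rw [h1, ih, prefixCylinder_succ, this]

end MarkovChain

/-! ### Runs of the product chain. -/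

section Product

variable {Ap Q S : Type*}

lemma DRA.track_congr (A : DRA Ap Q) (L : S → Set Ap) {ρ ρ' : ℕ → S} {n : ℕ}
    (h : ∀ i ≤ n, ρ i = ρ' i) : A.track L ρ n = A.track L ρ' n := by
  induction n with
  | zero => simp [DRA.track, h 0 le_rfl]
  | succ n ih => simp only [DRA.track, ih (fun i hi => h i (by omega)), h (n + 1) le_rfl]

variable [Fintype S] [MeasurableSpace S] [MeasurableSingletonClass S]
  [Fintype Q] [MeasurableSpace Q]

lemma DRA.measurable_lift (A : DRA Ap Q) (L : S → Set Ap) : Measurable (A.lift L) := by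
  refine measurable_pi_lambda _ (fun n => (measurable_pi_apply n).prodMk ?_)
  refine measurable_to_countable' (fun q => ?_)
  have : PrefixDetermined n ((fun ρ : ℕ → S => A.track L ρ n) ⁻¹' {q}) := by
    intro ρ ρ' h hq
    simpa [A.track_congr L h] using hq
  exact this.measurableSet

variable [MeasurableSingletonClass Q]

/-- The runs of the product chain are the lifted runs of the chain. -/
lemma MarkovChain.product_runMeasure (M : MarkovChain S) (L : S → Set Ap) (A : DRA Ap Q) :
    (M.product L A).runMeasure = M.runMeasure.map (A.lift L) := by
  classical
  symm
  have hpd : ∀ (x : ℕ → S × Q) n, PrefixDetermined n (A.lift L ⁻¹' prefixCylinder x n) := by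
    intro x n ρ ρ' h hx i hi
    rw [← hx i hi]
    simp only [DRA.lift, h i hi]
    rw [A.track_congr L (fun j hj => h j (hj.trans hi))]
  have hmc : ∀ (x : ℕ → S × Q) n, MeasurableSet (prefixCylinder x n) :=
    fun x n => (prefixDetermined_prefixCylinder x n).measurableSet
  have : IsProbabilityMeasure (M.runMeasure.map (A.lift L)) :=
    Measure.isProbabilityMeasure_map (A.measurable_lift L).aemeasurable
  apply runMeasure_unique
  · intro x
    rw [Measure.map_apply (A.measurable_lift L) (hmc x 0)]
    simp only [product, PMF.map_apply]
    rw [tsum_eq_single (x 0).1]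
    · by_cases hx : A.next A.start (L (x 0).1) = (x 0).2
      · rw [if_pos (by rw [hx]), ← runMeasure_zero]
        congr 1
        ext ρ
        simp only [Set.mem_preimage, prefixCylinder, Set.mem_ofPred_eq, nonpos_iff_eq_zero,
          forall_eq, DRA.lift, DRA.track]
        constructor
        · intro h; rw [← h]
        · intro h; rw [h, hx]
      -- The automaton component of `x 0` is not the forced one, so both sides vanish.
      · rw [if_neg (fun h => hx (by rw [h]))]
        convert measure_empty (μ := M.runMeasure)
        ext ρ
        simp only [Set.mem_preimage, prefixCylinder, Set.mem_ofPred_eq, nonpos_iff_eq_zero,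
          forall_eq, DRA.lift, DRA.track, Set.mem_empty_iff_false, iff_false]
        intro h
        rw [← h] at hx
        exact hx rfl
    · intro s hs
      rw [if_neg]
      intro h
      rw [h] at hs
      exact hs rfl
  · intro x n
    rw [Measure.map_apply (A.measurable_lift L) (hmc x _),
      Measure.map_apply (A.measurable_lift L) (hmc x _)]
    simp only [product, PMF.map_apply]
    have h4 : A.lift L ⁻¹' prefixCylinder x n ∩ {ρ | ρ n = (x n).1} =
        A.lift L ⁻¹' prefixCylinder x n :=
      Set.inter_eq_left.2 (fun ρ hρ => congrArg Prod.fst (hρ n le_rfl))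
    have hs := runMeasure_succ M (hpd x n) (x n).1 (x (n + 1)).1
    rw [h4] at hs
    rw [tsum_eq_single (x (n + 1)).1]
    · by_cases hx : A.next (x n).2 (L (x (n + 1)).1) = (x (n + 1)).2
      · rw [if_pos (by rw [hx]), ← hs, prefixCylinder_succ]
        congr 1
        ext ρ
        simp only [Set.mem_preimage, Set.mem_inter_iff, Set.mem_ofPred_eq]
        refine and_congr_right (fun h => ?_)
        have h' : A.track L ρ n = (x n).2 := congrArg Prod.snd (h n le_rfl)
        simp only [DRA.lift, DRA.track, h']
        constructor
        · intro h; rw [← h]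
        · intro h; rw [h, hx]
      · rw [if_neg (fun h => hx (by rw [h])), mul_zero]
        convert measure_empty (μ := M.runMeasure)
        rw [prefixCylinder_succ]
        ext ρ
        simp only [Set.mem_preimage, Set.mem_inter_iff, Set.mem_ofPred_eq,
          Set.mem_empty_iff_false, iff_false, not_and]
        intro h h2
        have h' : A.track L ρ n = (x n).2 := congrArg Prod.snd (h n le_rfl)
        rw [← h2] at hx
        simp only [DRA.lift, DRA.track, h', not_true_eq_false] at hx
    · intro s hs
      rw [if_neg]
      intro h
      rw [h] at hs
      exact hs rfl

end Product

/-! ### Hitting times -/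

section FirstTime

lemma firstTime_le {A : ℕ → Prop} {n : ℕ} (h : A n) : firstTime A ≤ n := iInf₂_le n h

lemma firstTime_mono {A A' : ℕ → Prop} (h : ∀ n, A n → A' n) : firstTime A' ≤ firstTime A :=
  le_iInf₂ (fun n hn => firstTime_le (h n hn))

lemma le_firstTime {A : ℕ → Prop} {n : ℕ} (h : ∀ i < n, ¬ A i) : (n : ℝ≥0∞) ≤ firstTime A := by
  refine le_iInf₂ (fun m hm => ?_)
  by_contra hcon
  exact h m (by exact_mod_cast not_le.1 hcon) hm

lemma firstTime_eq {A : ℕ → Prop} {n : ℕ} (h : A n) (h' : ∀ i < n, ¬ A i) : firstTime A = n :=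
  le_antisymm (firstTime_le h) (le_firstTime h')

lemma exists_first {A : ℕ → Prop} (h : ∃ n, A n) : ∃ n, A n ∧ ∀ i < n, ¬ A i := by
  classical
  exact ⟨Nat.find h, Nat.find_spec h, fun i hi => Nat.find_min h hi⟩

lemma exists_of_firstTime_ne_top {A : ℕ → Prop} (h : firstTime A ≠ ⊤) : ∃ n, A n := by
  by_contra hcon
  push Not at hcon
  exact h (by simp [firstTime, hcon])

/-- The tail-sum formula: expected first times become sums of survival probabilities. -/
lemma firstTime_eq_tsum (A : ℕ → Prop) :
    firstTime A = ∑' j : ℕ, {j | ∀ i ≤ j, ¬ A i}.indicator (1 : ℕ → ℝ≥0∞) j := by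
  classical
  by_cases h : ∃ n, A n
  · obtain ⟨n, hn, hmin⟩ := exists_first h
    rw [firstTime_eq hn hmin, tsum_eq_sum (s := Finset.range n)]
    · rw [Finset.sum_congr rfl (g := fun _ => (1 : ℝ≥0∞))]
      · simp
      · intro j hj
        rw [Set.indicator_of_mem]; · rfl
        exact fun i hi => hmin i (by have := Finset.mem_range.1 hj; omega)
    · intro j hj
      rw [Set.indicator_of_notMem]
      exact fun hj' => hj' n (by simpa using hj) hn
  · push Not at h
    have : {j | ∀ i ≤ j, ¬ A i} = Set.univ := by ext j; simp [h]
    rw [this]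
    simp [firstTime, h]

lemma measurable_firstTime {Ω : Type*} [MeasurableSpace Ω] {A : Ω → ℕ → Prop}
    (h : ∀ n, MeasurableSet {ρ | A ρ n}) : Measurable (fun ρ => firstTime (A ρ)) := by
  classical
  have : (fun ρ => firstTime (A ρ)) = fun ρ => ⨅ n : ℕ, if A ρ n then (n : ℝ≥0∞) else ⊤ := by
    funext ρ
    unfold firstTime
    congr 1
    funext n
    by_cases hA : A ρ n <;> simp [hA]
  rw [this]
  exact Measurable.iInf (fun n => Measurable.ite (h n) measurable_const measurable_const)

end FirstTime

/-! ### Expected hitting times in closed sets. -/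

namespace MarkovChain

variable {S : Type*}

open Classical in
/-- The states of `C` from which `A` is reached in at most `l` steps. -/
def reachWithin (M : MarkovChain S) (C : Finset S) (A : Set S) : ℕ → Finset S
  | 0 => C.filter (· ∈ A)
  | l + 1 => C.filter (fun u => u ∈ M.reachWithin C A l ∨ ∃ w ∈ M.reachWithin C A l, M.edge u w)


lemma reachWithin_subset (M : MarkovChain S) (C : Finset S) (A : Set S) (l : ℕ) :
    M.reachWithin C A l ⊆ C := by
  classical
  cases l <;> exact Finset.filter_subset _ _

lemma reachWithin_subset_succ (M : MarkovChain S) (C : Finset S) (A : Set S) (l : ℕ) :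
    M.reachWithin C A l ⊆ M.reachWithin C A (l + 1) := by
  intro u hu
  simp only [reachWithin, Finset.mem_filter]
  exact ⟨M.reachWithin_subset C A l hu, Or.inl hu⟩

/-- The sets start non-empty and grow strictly until they are stationary, and a stationary one is
all of `C`. So `C.card - 1` steps suffice. -/
lemma reachWithin_card (M : MarkovChain S) {C : Finset S} {A : Set S} (hC0 : C.Nonempty)
    (hC : ∀ s ∈ C, ∀ s', M.edge s s' → s' ∈ C)
    (hA : ∀ s ∈ C, ∃ w ∈ A, Relation.ReflTransGen M.edge s w) :
    M.reachWithin C A (C.card - 1) = C := by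
  classical
  have hw : ∀ s ∈ C, ∀ w, Relation.ReflTransGen M.edge s w → w ∈ C := by
    intro s hs w h
    induction h with
    | refl => exact hs
    | tail _ he ih => exact hC _ ih _ he
  have h0 : ∀ w ∈ C, w ∈ A → ∀ l, w ∈ M.reachWithin C A l := by
    intro w hwC hwA l
    induction l with
    | zero => simp only [reachWithin, Finset.mem_filter]; exact ⟨hwC, hwA⟩
    | succ l ih => exact M.reachWithin_subset_succ C A l ih
  have hstab : ∀ l, M.reachWithin C A l = M.reachWithin C A (l + 1) →
      M.reachWithin C A l = C := by
    intro l hl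
    refine Finset.Subset.antisymm (M.reachWithin_subset C A l) (fun s hs => ?_)
    obtain ⟨w, hwA, h⟩ := hA s hs
    have hwC := hw s hs w h
    revert hs
    induction h using Relation.ReflTransGen.head_induction_on with
    | refl => intro hs; exact h0 w hwC hwA l
    | head he _ ih =>
      intro hs
      rw [hl]
      simp only [reachWithin, Finset.mem_filter]
      exact ⟨hs, Or.inr ⟨_, ih (hC _ hs _ he), he⟩⟩
  have key : ∀ l, M.reachWithin C A l = C ∨ l + 1 ≤ (M.reachWithin C A l).card := by
    intro l
    induction l with
    | zero =>
      right
      obtain ⟨s, hs⟩ := hC0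
      obtain ⟨w, hwA, h⟩ := hA s hs
      exact Finset.card_pos.2 ⟨w, h0 w (hw s hs w h) hwA 0⟩
    | succ l ih =>
      have hsub := M.reachWithin_subset_succ C A l
      rcases ih with h | h
      · left
        rw [h] at hsub
        exact Finset.Subset.antisymm (M.reachWithin_subset C A _) hsub
      · by_cases heq : M.reachWithin C A l = M.reachWithin C A (l + 1)
        · left; rw [← heq]; exact hstab l heq
        · right
          have := Finset.card_lt_card (Finset.ssubset_iff_subset_ne.2 ⟨hsub, heq⟩)
          omega
  rcases key (C.card - 1) with h | h
  · exact h
  · have := Finset.card_pos.2 hC0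
    exact Finset.eq_of_subset_of_card_le (M.reachWithin_subset C A _) (by omega)

lemma prefixDetermined_hitWithin (A : Set S) (l : ℕ) :
    PrefixDetermined l {ρ : ℕ → S | ∃ i ≤ l, ρ i ∈ A} := by
  rintro ρ ρ' h ⟨i, hi, hA⟩
  exact ⟨i, hi, by rw [← h i hi]; exact hA⟩

lemma prefixDetermined_miss (A : Set S) (l : ℕ) :
    PrefixDetermined l {ρ : ℕ → S | ∀ i ≤ l, ¬ (1 ≤ i ∧ ρ i ∈ A)} := by
  intro ρ ρ' h hρ i hi
  rw [← h i hi]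
  exact hρ i hi

lemma exists_edge (M : MarkovChain S) (s : S) : ∃ w, M.edge s w := by
  obtain ⟨w, hw⟩ := (M.step s).support_nonempty
  exact ⟨w, ENNReal.toReal_pos ((PMF.mem_support_iff _ _).1 hw) (PMF.apply_ne_top _ _)⟩

variable [Fintype S] [MeasurableSpace S] [MeasurableSingletonClass S]

lemma setLIntegral_shiftSeq (M : MarkovChain S) {n : ℕ} {E : Set (ℕ → S)}
    (hE : PrefixDetermined n E) {f : (ℕ → S) → ℝ≥0∞} (hf : Measurable f) :
    ∫⁻ ρ in E, f (shiftSeq n ρ) ∂M.runMeasure =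
      ∑ u : S, M.runMeasure (E ∩ {ρ | ρ n = u}) * ∫⁻ ρ, f ρ ∂(M.startAt u).runMeasure := by
  have h1 : E = ⋃ u ∈ (Finset.univ : Finset S), E ∩ {ρ | ρ n = u} := by ext ρ; simp
  conv_lhs => rw [h1]
  rw [lintegral_biUnion_finset]
  · exact Finset.sum_congr rfl (fun u _ => M.lintegral_shiftSeq hE u hf)
  · intro u _ w _ huw
    refine Set.disjoint_left.2 (fun ρ h h' => huw ?_)
    exact h.2.symm.trans h'.2
  · exact fun u _ => (hE.inter (prefixDetermined_eval le_rfl {u})).measurableSet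

lemma sum_runMeasure_inter (M : MarkovChain S) {n : ℕ} {E : Set (ℕ → S)}
    (hE : PrefixDetermined n E) : ∑ u : S, M.runMeasure (E ∩ {ρ | ρ n = u}) = M.runMeasure E := by
  have := M.setLIntegral_shiftSeq hE (f := fun _ => 1) measurable_const
  simpa using this.symm

lemma setLIntegral_shiftSeq_le (M : MarkovChain S) {n : ℕ} {E : Set (ℕ → S)}
    (hE : PrefixDetermined n E) {f : (ℕ → S) → ℝ≥0∞} (hf : Measurable f) {C : Set S} {K : ℝ≥0∞}
    (hC : ∀ᵐ ρ ∂M.runMeasure, ρ ∈ E → ρ n ∈ C)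
    (hK : ∀ u ∈ C, ∫⁻ ρ, f ρ ∂(M.startAt u).runMeasure ≤ K) :
    ∫⁻ ρ in E, f (shiftSeq n ρ) ∂M.runMeasure ≤ M.runMeasure E * K := by
  rw [M.setLIntegral_shiftSeq hE hf, ← M.sum_runMeasure_inter hE, Finset.sum_mul]
  refine Finset.sum_le_sum (fun u _ => ?_)
  by_cases hu : u ∈ C
  · gcongr; exact hK u hu
  · have : M.runMeasure (E ∩ {ρ | ρ n = u}) = 0 := by
      refine measure_mono_null (fun ρ hρ => ?_) (ae_iff.1 hC)
      intro h
      exact hu (hρ.2 ▸ h hρ.1)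
    simp [this]

/-- A bound on the integral over the runs, split according to a stopping time. -/
lemma lintegral_le_of_stopping (M : MarkovChain S) {E : ℕ → Set (ℕ → S)}
    (hE : ∀ n, PrefixDetermined n (E n)) (hdis : Pairwise (Function.onFun Disjoint E))
    (hcov : ∀ᵐ ρ ∂M.runMeasure, ∃ n, ρ ∈ E n) {F : (ℕ → S) → ℝ≥0∞} {f : ℕ → (ℕ → S) → ℝ≥0∞}
    (hf : ∀ n, Measurable (f n)) {C : Set S} {c K : ℕ → ℝ≥0∞}
    (hC : ∀ n, ∀ᵐ ρ ∂M.runMeasure, ρ ∈ E n → ρ n ∈ C)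
    (hK : ∀ n, ∀ u ∈ C, ∫⁻ ρ, f n ρ ∂(M.startAt u).runMeasure ≤ K n)
    (hF : ∀ n, ∀ᵐ ρ ∂M.runMeasure, ρ ∈ E n → F ρ ≤ c n + f n (shiftSeq n ρ)) :
    ∫⁻ ρ, F ρ ∂M.runMeasure ≤ ∑' n, M.runMeasure (E n) * (c n + K n) := by
  have hU : ∫⁻ ρ, F ρ ∂M.runMeasure = ∫⁻ ρ in ⋃ n, E n, F ρ ∂M.runMeasure := by
    rw [← setLIntegral_univ]
    apply setLIntegral_congr
    filter_upwards [hcov] with ρ hρ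
    exact propext ⟨fun _ => Set.mem_iUnion.2 hρ, fun _ => trivial⟩
  rw [hU, lintegral_iUnion (fun n => (hE n).measurableSet) hdis]
  refine ENNReal.tsum_le_tsum (fun n => ?_)
  calc ∫⁻ ρ in E n, F ρ ∂M.runMeasure
      ≤ ∫⁻ ρ in E n, (c n + f n (shiftSeq n ρ)) ∂M.runMeasure :=
        setLIntegral_mono_ae' (hE n).measurableSet (hF n)
    _ = c n * M.runMeasure (E n) + ∫⁻ ρ in E n, f n (shiftSeq n ρ) ∂M.runMeasure := by
        rw [lintegral_add_left measurable_const, setLIntegral_const]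
    _ ≤ c n * M.runMeasure (E n) + M.runMeasure (E n) * K n := by
        gcongr
        exact M.setLIntegral_shiftSeq_le (hE n) (hf n) (hC n) (hK n)
    _ = _ := by ring

lemma ae_mem_of_closed (M : MarkovChain S) {C : Set S}
    (hC : ∀ s ∈ C, ∀ s', M.edge s s' → s' ∈ C) {s : S} (hs : s ∈ C) :
    ∀ᵐ ρ ∂(M.startAt s).runMeasure, ∀ n, ρ n ∈ C := by
  filter_upwards [M.startAt_runMeasure_zero s, (M.startAt s).ae_edge] with ρ h0 he n
  induction n with
  | zero => rw [h0]; exact hs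
  | succ n ih => exact hC _ ih _ (he n)

lemma startAt_runMeasure_one (M : MarkovChain S) (s w : S) :
    (M.startAt s).runMeasure {ρ | ρ 1 = w} = M.step s w := by
  have h := (M.startAt s).runMeasure_succ (prefixDetermined_univ 0) s w
  have h0 : (M.startAt s).runMeasure {ρ | ρ 0 = s} = 1 := by
    rw [runMeasure_zero]; simp [startAt]
  rw [Set.univ_inter, h0, one_mul] at h
  rw [show M.step s w = (M.startAt s).step s w from rfl, ← h]
  apply measure_congr
  filter_upwards [M.startAt_runMeasure_zero s] with ρ hρ
  exact propext ⟨fun h => ⟨hρ, h⟩, fun h => h.2⟩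

lemma step_mul_le_hit (M : MarkovChain S) {A : Set S} {x : ℝ≥0∞} {s w : S} {l : ℕ}
    (hx : x ≤ M.step s w)
    (hw : x ^ l ≤ (M.startAt w).runMeasure {ρ | ∃ i ≤ l, ρ i ∈ A}) :
    x ^ (l + 1) ≤ (M.startAt s).runMeasure {ρ | ∃ i ≤ l + 1, 1 ≤ i ∧ ρ i ∈ A} := by
  have hm := (prefixDetermined_hitWithin A l).measurableSet
  have h1 := (M.startAt s).lintegral_shiftSeq (prefixDetermined_univ 1) w
    (f := {ρ | ∃ i ≤ l, ρ i ∈ A}.indicator 1) (measurable_one.indicator hm)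
  rw [lintegral_indicator_one hm, Set.univ_inter, M.startAt_runMeasure_one,
    show ((M.startAt s).startAt w) = M.startAt w from rfl] at h1
  calc x ^ (l + 1) = x * x ^ l := by ring
    _ ≤ M.step s w * (M.startAt w).runMeasure {ρ | ∃ i ≤ l, ρ i ∈ A} := by gcongr
    _ = _ := h1.symm
    _ ≤ ∫⁻ ρ, {ρ | ∃ i ≤ l, ρ i ∈ A}.indicator 1 (shiftSeq 1 ρ) ∂(M.startAt s).runMeasure :=
        setLIntegral_le_lintegral _ _
    _ = ∫⁻ ρ, (shiftSeq 1 ⁻¹' {ρ | ∃ i ≤ l, ρ i ∈ A}).indicator 1 ρ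
          ∂(M.startAt s).runMeasure := rfl
    _ = (M.startAt s).runMeasure (shiftSeq 1 ⁻¹' {ρ | ∃ i ≤ l, ρ i ∈ A}) :=
        lintegral_indicator_one (measurable_shiftSeq 1 hm)
    _ ≤ _ := by
        refine measure_mono ?_
        rintro ρ ⟨i, hi, hA⟩
        exact ⟨1 + i, by omega, by omega, hA⟩

lemma pow_le_hitWithin (M : MarkovChain S) {C : Finset S} {A : Set S} {x : ℝ≥0∞} (hx1 : x ≤ 1)
    (hx : ∀ s s', M.edge s s' → x ≤ M.step s s') (l : ℕ) :
    ∀ u ∈ M.reachWithin C A l, x ^ l ≤ (M.startAt u).runMeasure {ρ | ∃ i ≤ l, ρ i ∈ A} := by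
  classical
  induction l with
  | zero =>
    intro u hu
    simp only [reachWithin, Finset.mem_filter] at hu
    rw [pow_zero]
    refine le_of_eq (Eq.symm ?_)
    have h1 : (M.startAt u).runMeasure {ρ | ρ 0 = u} = 1 := by
      rw [runMeasure_zero]; simp [startAt]
    refine le_antisymm prob_le_one (h1.symm.le.trans (measure_mono ?_))
    intro ρ hρ
    exact ⟨0, le_rfl, by rw [hρ]; exact hu.2⟩
  | succ l ih =>
    intro u hu
    simp only [reachWithin, Finset.mem_filter] at hu
    rcases hu.2 with h | ⟨w, hw, he⟩
    · calc x ^ (l + 1) ≤ x ^ l := pow_le_pow_right_of_le_one' hx1 (Nat.le_succ l)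
        _ ≤ _ := ih u h
        _ ≤ _ := measure_mono (by
            rintro ρ ⟨i, hi, hA⟩
            exact ⟨i, by omega, hA⟩)
    · refine (M.step_mul_le_hit (hx u w he) (ih w hw)).trans (measure_mono ?_)
      rintro ρ ⟨i, hi, _, hA⟩
      exact ⟨i, hi, hA⟩

/-- The expected time to hit `A` from a closed set in which `A` is always reachable. -/
lemma lintegral_hit_le (M : MarkovChain S) {C : Finset S} {A : Set S} {x : ℝ≥0∞} (hx0 : x ≠ 0)
    (hx1 : x ≤ 1) (hx : ∀ s s', M.edge s s' → x ≤ M.step s s')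
    (hC : ∀ s ∈ C, ∀ s', M.edge s s' → s' ∈ C)
    (hA : ∀ s ∈ C, ∃ w ∈ A, Relation.ReflTransGen M.edge s w) :
    ∀ s ∈ C, ∫⁻ ρ, firstTime (fun n => 1 ≤ n ∧ ρ n ∈ A) ∂(M.startAt s).runMeasure ≤
      C.card / x ^ C.card := by
  classical
  rcases C.eq_empty_or_nonempty with rfl | hC0
  · simp
  set m := C.card with hm
  have hm1 : 1 ≤ m := Finset.card_pos.2 hC0
  set miss : ℕ → Set (ℕ → S) := fun j => {ρ | ∀ i ≤ j, ¬ (1 ≤ i ∧ ρ i ∈ A)} with hmiss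
  have hpd : ∀ j, PrefixDetermined j (miss j) := prefixDetermined_miss A
  have hxm : x ^ m ≤ 1 := pow_le_one' hx1 m
  have hxm0 : x ^ m ≠ 0 := pow_ne_zero _ hx0
  -- One arbitrary step, as time 0 does not count, and then at most `m - 1` steps to the target.
  have hmissm : ∀ s ∈ C, (M.startAt s).runMeasure (miss m) ≤ 1 - x ^ m := by
    intro s hs
    obtain ⟨w, hw⟩ := M.exists_edge s
    have hwB : w ∈ M.reachWithin C A (m - 1) := by
      rw [M.reachWithin_card hC0 hC hA]; exact hC s hs w hw
    have h1 := M.step_mul_le_hit (hx s w hw) (M.pow_le_hitWithin hx1 hx (m - 1) w hwB)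
    rw [show m - 1 + 1 = m by omega] at h1
    have h2 : miss m = {ρ | ∃ i ≤ m, 1 ≤ i ∧ ρ i ∈ A}ᶜ := by
      ext ρ; simp [hmiss]
    have h3 : MeasurableSet {ρ : ℕ → S | ∃ i ≤ m, 1 ≤ i ∧ ρ i ∈ A} := by
      have := (hpd m).measurableSet.compl
      rwa [h2, compl_compl] at this
    rw [h2, prob_compl_eq_one_sub h3]
    exact tsub_le_tsub_left h1 1
  have hshift : ∀ j, miss (m + j) ⊆ miss m ∩ shiftSeq m ⁻¹' miss j := by
    intro j ρ hρ
    refine ⟨fun i hi => hρ i (by omega), fun i hi h => hρ (m + i) (by omega) ⟨by omega, h.2⟩⟩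
  -- Truncated sums are finite, so that the recursive inequality `H ≤ m + (1 - x ^ m) * H` for their
  -- maximum can be solved by cancellation.
  set g : ℕ → S → ℝ≥0∞ := fun N s => ∑ j ∈ Finset.range N, (M.startAt s).runMeasure (miss j)
    with hg
  have hbound : ∀ N, ∀ s ∈ C, g N s ≤ m / x ^ m := by
    intro N
    set H := C.sup (g N) with hH
    have hHN : H ≤ N := by
      refine Finset.sup_le (fun s _ => ?_)
      calc g N s ≤ ∑ j ∈ Finset.range N, 1 := Finset.sum_le_sum (fun j _ => prob_le_one)
        _ = N := by simp
    have hHtop : H ≠ ⊤ := ne_top_of_le_ne_top (by simp) hHN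
    have hstep : ∀ s ∈ C, g N s ≤ m + (1 - x ^ m) * H := by
      intro s hs
      have h1 : g N s ≤ m + ∑ j ∈ Finset.range N, (M.startAt s).runMeasure (miss (m + j)) := by
        calc g N s ≤ ∑ j ∈ Finset.range (m + N), (M.startAt s).runMeasure (miss j) :=
              Finset.sum_le_sum_of_subset (Finset.range_mono (by omega))
          _ = _ := Finset.sum_range_add _ _ _
          _ ≤ _ := by
              gcongr
              calc _ ≤ ∑ j ∈ Finset.range m, 1 := Finset.sum_le_sum (fun j _ => prob_le_one)
                _ = (m : ℝ≥0∞) := by simp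
      refine h1.trans ?_
      gcongr
      have h2 : Measurable (fun ρ : ℕ → S => ∑ j ∈ Finset.range N, (miss j).indicator
          (1 : (ℕ → S) → ℝ≥0∞) ρ) :=
        Finset.measurable_sum _ (fun j _ => measurable_one.indicator (hpd j).measurableSet)
      have h3 := (M.startAt s).setLIntegral_shiftSeq_le (hpd m) h2 (C := C) (K := H)
        (by filter_upwards [M.ae_mem_of_closed (C := C) hC hs] with ρ h _ using h m)
        (by
          intro u hu
          rw [lintegral_finsetSum _
            (fun j _ => measurable_one.indicator (hpd j).measurableSet)]
          have : ∀ j, ∫⁻ ρ, (miss j).indicator (1 : (ℕ → S) → ℝ≥0∞) ρ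
              ∂((M.startAt s).startAt u).runMeasure = (M.startAt u).runMeasure (miss j) :=
            fun j => lintegral_indicator_one (hpd j).measurableSet
          simp only [this]
          exact Finset.le_sup (f := g N) hu)
      calc ∑ j ∈ Finset.range N, (M.startAt s).runMeasure (miss (m + j))
          ≤ ∑ j ∈ Finset.range N, ∫⁻ ρ in miss m, (miss j).indicator
              (1 : (ℕ → S) → ℝ≥0∞) (shiftSeq m ρ) ∂(M.startAt s).runMeasure := by
            refine Finset.sum_le_sum (fun j _ => ?_)
            refine (measure_mono (hshift j)).trans (le_of_eq ?_)
            have h4 := measurable_shiftSeq m (hpd j).measurableSet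
            rw [Set.inter_comm, ← Measure.restrict_apply h4, ← lintegral_indicator_one h4]
            rfl
        _ = ∫⁻ ρ in miss m, ∑ j ∈ Finset.range N, (miss j).indicator
              (1 : (ℕ → S) → ℝ≥0∞) (shiftSeq m ρ) ∂(M.startAt s).runMeasure := by
            refine (lintegral_finsetSum _ (fun j _ => ?_)).symm
            exact (measurable_one.indicator (hpd j).measurableSet).comp (measurable_shiftSeq m)
        _ ≤ (M.startAt s).runMeasure (miss m) * H := h3
        _ ≤ _ := by gcongr; exact hmissm s hs
    have hHle : H ≤ m + (1 - x ^ m) * H := Finset.sup_le hstep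
    have hfin : (1 - x ^ m) * H ≠ ⊤ := ENNReal.mul_ne_top (by simp) hHtop
    have h5 : x ^ m * H + (1 - x ^ m) * H = H := by
      rw [← add_mul, add_tsub_cancel_of_le hxm, one_mul]
    have h6 : x ^ m * H ≤ m := by
      rw [← h5] at hHle
      conv at hHle => rhs; rw [h5]
      exact (ENNReal.add_le_add_iff_right hfin).1 hHle
    have h7 : H ≤ m / x ^ m := by
      rw [ENNReal.le_div_iff_mul_le (Or.inl hxm0) (Or.inl (ne_top_of_le_ne_top (by simp) hxm)),
        mul_comm]
      exact h6
    exact fun s hs => (Finset.le_sup (f := g N) hs).trans h7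
  intro s hs
  have h8 : ∀ ρ : ℕ → S, firstTime (fun n => 1 ≤ n ∧ ρ n ∈ A) =
      ∑' j, (miss j).indicator (1 : (ℕ → S) → ℝ≥0∞) ρ := by
    intro ρ
    rw [firstTime_eq_tsum]
    rfl
  simp only [h8]
  rw [lintegral_tsum (fun j => (measurable_one.indicator (hpd j).measurableSet).aemeasurable)]
  apply ENNReal.tsum_le_of_sum_range_le
  intro N
  simp only [lintegral_indicator_one (hpd _).measurableSet]
  exact hbound N s hs

end MarkovChain

/-! ### Bottom components and the smallest transition probability -/

namespace MarkovChain

section Graph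

variable {S : Type*} [Fintype S]

/-- Among the states reachable from `s`, take one with the fewest successors in the transitive
closure: each of these successors has the same successor set. -/
lemma exists_BSCC_reachable (M : MarkovChain S) (s : S) :
    ∃ C, M.BSCC C ∧ ∃ w ∈ C, Relation.ReflTransGen M.edge s w := by
  classical
  set D : S → Finset S := fun t => Finset.univ.filter (fun w => Relation.TransGen M.edge t w)
    with hD
  have hmem : ∀ t w, w ∈ D t ↔ Relation.TransGen M.edge t w := fun t w => by simp [hD]
  obtain ⟨t, ht, hmin⟩ := (Finset.univ.filter
    (fun t => Relation.ReflTransGen M.edge s t)).exists_min_image (fun t => (D t).card)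
      ⟨s, by simpa using Relation.ReflTransGen.refl⟩
  have hst : Relation.ReflTransGen M.edge s t := by simpa using ht
  have heq : ∀ w ∈ D t, D w = D t := by
    intro w hw
    rw [hmem] at hw
    refine Finset.eq_of_subset_of_card_le (fun z hz => ?_) (hmin w ?_)
    · rw [hmem] at hz ⊢; exact hw.trans hz
    · simpa using hst.trans hw.to_reflTransGen
  obtain ⟨w, hw⟩ := M.exists_edge t
  have hwD : w ∈ D t := (hmem t w).2 (.single hw)
  refine ⟨D t, isBSCC_of_isSC_of_closed ⟨⟨w, hwD⟩, fun x hx y hy => ?_⟩ (fun x hx y he => ?_),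
    w, hwD, hst.tail hw⟩
  · rw [← heq x hx] at hy; exact (hmem x y).1 hy
  · rw [hmem] at hx ⊢; exact hx.tail he

lemma BSCC.closed {S : Type*} {M : MarkovChain S} {C : Finset S} (h : M.BSCC C) :
    ∀ s ∈ C, ∀ s', M.edge s s' → s' ∈ C := by
  intro s hs s' he
  by_contra hs'
  exact h.2 s hs s' hs' he

lemma pmin_mem (M : MarkovChain S) : 0 < M.pmin ∧ ∃ s s', M.prob s s' = M.pmin := by
  obtain ⟨s, -⟩ := M.start.support_nonempty
  obtain ⟨w, hw⟩ := M.exists_edge s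
  have hne : {x : ℝ | 0 < x ∧ ∃ s s', M.prob s s' = x}.Nonempty := ⟨_, hw, s, w, rfl⟩
  have hfin : {x : ℝ | 0 < x ∧ ∃ s s', M.prob s s' = x}.Finite := by
    refine (Set.finite_range (fun y : S × S => M.prob y.1 y.2)).subset ?_
    rintro x ⟨_, s, s', rfl⟩
    exact ⟨(s, s'), rfl⟩
  exact hne.csInf_mem hfin

lemma pmin_pos (M : MarkovChain S) : 0 < M.pmin := M.pmin_mem.1

lemma pmin_le {S : Type*} (M : MarkovChain S) {s s' : S} (h : M.edge s s') : M.pmin ≤ M.prob s s' :=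
  csInf_le ⟨0, fun _ hx => hx.1.le⟩ ⟨h, s, s', rfl⟩

lemma ofReal_pmin_le {S : Type*} (M : MarkovChain S) {s s' : S} (h : M.edge s s') :
    ENNReal.ofReal M.pmin ≤ M.step s s' := by
  rw [← ENNReal.ofReal_toReal (PMF.apply_ne_top (M.step s) s')]
  exact ENNReal.ofReal_le_ofReal (M.pmin_le h)

lemma sum_prob {S : Type*} [Fintype S] (M : MarkovChain S) (s : S) : ∑ s', M.prob s s' = 1 := by
  have h := PMF.tsum_coe (M.step s)
  rw [tsum_fintype] at h
  unfold prob
  rw [← ENNReal.toReal_sum (fun a _ => PMF.apply_ne_top _ _), h, ENNReal.toReal_one]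

/-- A row containing the minimal entry has mass left over, hence a second positive entry, which is
at least as large. This makes the denominator of the strength at most 1. -/
lemma pmin_le_half (M : MarkovChain S) (h : M.pmin < 1) : M.pmin ≤ 1 / 2 := by
  classical
  obtain ⟨_, s, s', hs⟩ := M.pmin_mem
  have h1 := M.sum_prob s
  rw [← Finset.add_sum_erase _ _ (Finset.mem_univ s'), hs] at h1
  have h2 : 0 < ∑ x ∈ Finset.univ.erase s', M.prob s x := by linarith
  obtain ⟨t, ht, ht0⟩ := Finset.exists_lt_of_sum_lt (s := Finset.univ.erase s') (f := fun _ => 0)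
    (g := fun x => M.prob s x) (by simpa using h2)
  have h3 := Finset.single_le_sum (f := fun x => M.prob s x) (s := Finset.univ.erase s')
    (fun x _ => ENNReal.toReal_nonneg) ht
  have h4 := M.pmin_le (s := s) (s' := t) ht0
  linarith

lemma pmin_product {S Ap Q : Type*} (M : MarkovChain S) (L : S → Set Ap) (A : DRA Ap Q) :
    (M.product L A).pmin = M.pmin := by
  classical
  have hprob : ∀ x y, (M.product L A).prob x y =
      if y.2 = A.next x.2 (L y.1) then M.prob x.1 y.1 else 0 := by
    rintro ⟨s, q⟩ ⟨s', q'⟩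
    simp only [prob, product, PMF.map_apply, Prod.mk.injEq]
    rw [tsum_eq_single s']
    · simp only [true_and]
      split_ifs <;> simp
    · intro b hb
      rw [if_neg]
      exact fun h => hb h.1.symm
  unfold pmin
  congr 1
  ext x
  simp only [Set.mem_ofPred_eq]
  refine and_congr_right (fun hx => ⟨?_, ?_⟩)
  · rintro ⟨y, z, h⟩
    rw [hprob] at h
    split_ifs at h
    · exact ⟨_, _, h⟩
    · exact absurd h hx.ne
  · rintro ⟨s, s', h⟩
    exact ⟨(s, A.start), (s', A.next A.start (L s')), by rw [hprob, if_pos rfl]; exact h⟩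

lemma card_le_maxBSCC (M : MarkovChain S) {C : Finset S} (h : M.BSCC C) : C.card ≤ M.maxBSCC := by
  classical
  unfold maxBSCC
  refine Finset.le_sup (f := Finset.card) ?_
  simpa using h

lemma one_le_maxBSCC (M : MarkovChain S) : 1 ≤ M.maxBSCC := by
  obtain ⟨s, -⟩ := M.start.support_nonempty
  obtain ⟨C, hC, w, hw, -⟩ := M.exists_BSCC_reachable s
  exact (Nat.succ_le_of_lt (Finset.card_pos.2 ⟨w, hw⟩)).trans (M.card_le_maxBSCC hC)

end Graph

variable {S : Type*} [Fintype S] [MeasurableSpace S] [MeasurableSingletonClass S]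

lemma maxHit_le (M : MarkovChain S) (h1 : M.pmin ≤ 1) :
    M.maxHit ≤ ENNReal.ofReal (M.maxBSCC / M.pmin ^ M.maxBSCC) := by
  refine iSup₂_le (fun C hC => iSup₂_le (fun s hs => iSup₂_le (fun s' hs' => ?_)))
  have hp := M.pmin_pos
  have hx1 : ENNReal.ofReal M.pmin ≤ 1 := ENNReal.ofReal_le_one.2 h1
  have h := M.lintegral_hit_le (C := C) (A := {s'}) (x := ENNReal.ofReal M.pmin)
    (by simpa using hp) hx1 (fun _ _ he => M.ofReal_pmin_le he) hC.closed
    (fun t ht => ⟨s', rfl, (hC.1.1.2 t ht s' hs').to_reflTransGen⟩) s hs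
  rw [ENNReal.ofReal_div_of_pos (by positivity), ENNReal.ofReal_pow hp.le, ENNReal.ofReal_natCast]
  refine h.trans (ENNReal.div_le_div (by exact_mod_cast M.card_le_maxBSCC hC) ?_)
  exact pow_le_pow_right_of_le_one' hx1 (M.card_le_maxBSCC hC)

lemma maxHit_ne_top (M : MarkovChain S) (h1 : M.pmin ≤ 1) : M.maxHit ≠ ⊤ :=
  ne_top_of_le_ne_top ENNReal.ofReal_ne_top (M.maxHit_le h1)

lemma expHit_le_maxHit (M : MarkovChain S) {C : Finset S} (hC : M.BSCC C) {s s' : S} (hs : s ∈ C)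
    (hs' : s' ∈ C) : M.expHit s s' ≤ M.maxHit := by
  unfold maxHit
  exact le_iSup₂_of_le C hC (le_iSup₂_of_le s hs (le_iSup₂_of_le s' hs' le_rfl))

lemma one_le_maxHit (M : MarkovChain S) : 1 ≤ M.maxHit := by
  obtain ⟨s, -⟩ := M.start.support_nonempty
  obtain ⟨C, hC, w, hw, -⟩ := M.exists_BSCC_reachable s
  refine le_trans ?_ (M.expHit_le_maxHit hC hw hw)
  calc (1 : ℝ≥0∞) = ∫⁻ _, 1 ∂(M.startAt w).runMeasure := by simp
    _ ≤ _ := by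
      refine lintegral_mono (fun ρ => ?_)
      have := le_firstTime (A := fun n => 1 ≤ n ∧ ρ n = w) (n := 1) (fun i hi h => by omega)
      simpa using this

lemma expReach_ne_top (M : MarkovChain S) (h1 : M.pmin ≤ 1) : M.expReach ≠ ⊤ := by
  set A : Set S := {s | ∃ C, M.BSCC C ∧ s ∈ C} with hA
  have hx1 : ENNReal.ofReal M.pmin ≤ 1 := ENNReal.ofReal_le_one.2 h1
  have hx0 : ENNReal.ofReal M.pmin ≠ 0 := by simpa using M.pmin_pos
  have h := M.lintegral_hit_le (C := Finset.univ) (A := A) hx0 hx1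
    (fun _ _ he => M.ofReal_pmin_le he) (fun _ _ _ _ => Finset.mem_univ _)
    (fun s _ => by
      obtain ⟨C, hC, w, hw, hr⟩ := M.exists_BSCC_reachable s
      exact ⟨w, ⟨C, hC, hw⟩, hr⟩)
  set K : ℝ≥0∞ := (Finset.univ : Finset S).card /
    ENNReal.ofReal M.pmin ^ (Finset.univ : Finset S).card with hK
  have hKtop : K ≠ ⊤ := ENNReal.div_ne_top (by simp) (pow_ne_zero _ hx0)
  have hm : Measurable (fun ρ : ℕ → S => firstTime (fun n => 1 ≤ n ∧ ρ n ∈ A)) :=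
    measurable_firstTime (fun n => PrefixDetermined.measurableSet (n := n) (by
      rintro ρ ρ' h ⟨h1, h2⟩
      exact ⟨h1, by rw [← h n le_rfl]; exact h2⟩))
  -- The Markov property at time 0 splits the run according to its start.
  have h2 := M.setLIntegral_shiftSeq_le (prefixDetermined_univ 0) hm (C := Set.univ) (K := K)
    (by simp) (fun u _ => h u (Finset.mem_univ u))
  rw [setLIntegral_univ, measure_univ, one_mul] at h2
  refine ne_top_of_le_ne_top hKtop (le_trans (lintegral_mono (fun ρ => ?_)) h2)
  refine firstTime_mono (fun n hn => ?_)
  have h3 := hn.2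
  simp only [shiftSeq, zero_add] at h3
  exact h3

/-! ### Stopping at a first time -/

/-- A bound on the integral over the runs by means of the expectation of a first time. -/
lemma lintegral_le_of_firstTime (M : MarkovChain S) {A : (ℕ → S) → ℕ → Prop}
    (hA : ∀ n, PrefixDetermined n {ρ | A ρ n})
    (hfin : ∫⁻ ρ, firstTime (A ρ) ∂M.runMeasure ≠ ⊤) {F : (ℕ → S) → ℝ≥0∞}
    {f : ℕ → (ℕ → S) → ℝ≥0∞} (hf : ∀ n, Measurable (f n)) {C : Set S} {k₁ k₀ : ℝ≥0∞}
    (hC : ∀ᵐ ρ ∂M.runMeasure, ∀ n, A ρ n → ρ n ∈ C)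
    (hK : ∀ n : ℕ, ∀ u ∈ C, ∫⁻ ρ, f n ρ ∂(M.startAt u).runMeasure ≤ n * k₁ + k₀)
    (hF : ∀ᵐ ρ ∂M.runMeasure, ∀ n, A ρ n → (∀ i < n, ¬ A ρ i) → F ρ ≤ n + f n (shiftSeq n ρ)) :
    ∫⁻ ρ, F ρ ∂M.runMeasure ≤ (∫⁻ ρ, firstTime (A ρ) ∂M.runMeasure) * (1 + k₁) + k₀ := by
  set E : ℕ → Set (ℕ → S) := fun n => {ρ | A ρ n ∧ ∀ i < n, ¬ A ρ i} with hE
  have hEpd : ∀ n, PrefixDetermined n (E n) := by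
    rintro n ρ ρ' h ⟨h1, h2⟩
    refine ⟨hA n ρ ρ' h h1, fun i hi h3 => h2 i hi ?_⟩
    exact hA i ρ' ρ (fun j hj => (h j (by omega)).symm) h3
  have hdis : Pairwise (Function.onFun Disjoint E) := by
    intro m n hmn
    refine Set.disjoint_left.2 (fun ρ h h' => ?_)
    rcases lt_or_gt_of_ne hmn with hlt | hlt
    · exact h'.2 m hlt h.1
    · exact h.2 n hlt h'.1
  have hmeas : Measurable (fun ρ => firstTime (A ρ)) :=
    measurable_firstTime (fun n => (hA n).measurableSet)
  have hcov : ∀ᵐ ρ ∂M.runMeasure, ∃ n, ρ ∈ E n := by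
    filter_upwards [ae_lt_top hmeas hfin] with ρ hρ
    exact exists_first (exists_of_firstTime_ne_top hρ.ne)
  have h1 := M.lintegral_le_of_stopping hEpd hdis hcov hf (C := C) (c := fun n => (n : ℝ≥0∞))
    (K := fun n => n * k₁ + k₀) (F := F)
    (fun n => by filter_upwards [hC] with ρ h hρ using h n hρ.1) hK
    (fun n => by filter_upwards [hF] with ρ h hρ using h n hρ.1 hρ.2)
  refine h1.trans ?_
  have h2 : ∑' n, M.runMeasure (E n) * (n : ℝ≥0∞) ≤ ∫⁻ ρ, firstTime (A ρ) ∂M.runMeasure := by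
    calc ∑' n, M.runMeasure (E n) * (n : ℝ≥0∞)
        = ∑' n, ∫⁻ ρ in E n, firstTime (A ρ) ∂M.runMeasure := by
          refine tsum_congr (fun n => ?_)
          rw [setLIntegral_congr_fun (g := fun _ => (n : ℝ≥0∞)) (hEpd n).measurableSet
            (fun ρ hρ => firstTime_eq hρ.1 hρ.2), setLIntegral_const, mul_comm]
      _ = ∫⁻ ρ in ⋃ n, E n, firstTime (A ρ) ∂M.runMeasure :=
          (lintegral_iUnion (fun n => (hEpd n).measurableSet) hdis _).symm
      _ ≤ _ := setLIntegral_le_lintegral _ _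
  have h3 : ∑' n, M.runMeasure (E n) ≤ 1 := by
    rw [← measure_iUnion hdis (fun n => (hEpd n).measurableSet)]
    exact prob_le_one
  calc ∑' n, M.runMeasure (E n) * (n + (n * k₁ + k₀))
      = ∑' n, (M.runMeasure (E n) * (n : ℝ≥0∞) * (1 + k₁) + M.runMeasure (E n) * k₀) :=
        tsum_congr (fun n => by ring)
    _ = (∑' n, M.runMeasure (E n) * (n : ℝ≥0∞)) * (1 + k₁) + (∑' n, M.runMeasure (E n)) * k₀ := by
        rw [ENNReal.tsum_add, ENNReal.tsum_mul_right, ENNReal.tsum_mul_right]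
    _ ≤ _ := by
        refine add_le_add (mul_le_mul_left h2 _) ?_
        calc _ ≤ 1 * k₀ := mul_le_mul_left h3 _
          _ = k₀ := one_mul _

end MarkovChain

/-! ### Tours -/

section Tours

open scoped List

lemma pathOf_add {V : Type*} (ρ : ℕ → V) (m n : ℕ) :
    pathOf ρ (m + n) = pathOf ρ m ++ pathOf (shiftSeq m ρ) n := by
  simp [pathOf, List.range_add, shiftSeq, Function.comp_def]

lemma pathOf_congr {V : Type*} {ρ ρ' : ℕ → V} {n : ℕ} (h : ∀ i < n, ρ i = ρ' i) :
    pathOf ρ n = pathOf ρ' n :=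
  List.map_congr_left (fun i hi => h i (List.mem_range.1 hi))

/-- The time that a run needs to visit the given states in the given order, after its start. -/
def tourTime {V : Type*} (L : List V) (ρ : ℕ → V) : ℝ≥0∞ :=
  firstTime (fun n => L <+ pathOf (shiftSeq 1 ρ) n)

/-- The list may depend on the start, since the component to be toured is known only on entry. -/
lemma prefixDetermined_tour {V : Type*} (g : V → List V) (n : ℕ) :
    PrefixDetermined n {ρ : ℕ → V | g (ρ 0) <+ pathOf (shiftSeq 1 ρ) n} := by
  intro ρ ρ' h hρ
  have h1 : pathOf (shiftSeq 1 ρ) n = pathOf (shiftSeq 1 ρ') n :=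
    pathOf_congr (fun i hi => h (1 + i) (by omega))
  rw [Set.mem_ofPred_eq] at hρ ⊢
  rwa [← h 0 (by omega), ← h1]

/-- A tour ignores the letter at time 0, so the visit to `a` at time `n` is not counted again by the
rest of the tour. This matches hitting times with at least one step. -/
lemma tourTime_cons_le {V : Type*} {a : V} {L : List V} {ρ : ℕ → V} {n : ℕ} (hn : 1 ≤ n)
    (ha : ρ n = a) : tourTime (a :: L) ρ ≤ n + tourTime L (shiftSeq n ρ) := by
  by_cases htop : tourTime L (shiftSeq n ρ) = ⊤
  · rw [htop]; simp
  · obtain ⟨k, hk, hmin⟩ := exists_first (exists_of_firstTime_ne_top htop)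
    have h1 : tourTime L (shiftSeq n ρ) = k := firstTime_eq hk hmin
    rw [h1]
    have h2 : a :: L <+ pathOf (shiftSeq 1 ρ) (n + k) := by
      rw [pathOf_add, ← List.singleton_append]
      refine List.Sublist.append (List.singleton_sublist.2 ?_) ?_
      · refine List.mem_map.2 ⟨n - 1, List.mem_range.2 (by omega), ?_⟩
        rw [← ha, shiftSeq]
        congr 1; omega
      · convert hk using 2
        funext i
        simp only [shiftSeq]
        congr 1; omega
    exact_mod_cast firstTime_le (A := fun n => a :: L <+ pathOf (shiftSeq 1 ρ) n) h2

variable {S : Type*} [Fintype S] [MeasurableSpace S] [MeasurableSingletonClass S]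

lemma measurable_tourTime (g : S → List S) :
    Measurable (fun ρ : ℕ → S => tourTime (g (ρ 0)) ρ) :=
  measurable_firstTime (fun n => (prefixDetermined_tour g n).measurableSet)

/-- Each leg costs at most `T` on average, and the run restarts afresh when its leg is completed. -/
lemma MarkovChain.lintegral_tourTime_le (M : MarkovChain S) {C : Finset S}
    {T : ℝ≥0∞} (hT : T ≠ ⊤) (hhit : ∀ s ∈ C, ∀ s' ∈ C, M.expHit s s' ≤ T) {L : List S}
    (hL : ∀ x ∈ L, x ∈ C) :
    ∀ s ∈ C, ∫⁻ ρ, tourTime L ρ ∂(M.startAt s).runMeasure ≤ L.length * T := by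
  induction L with
  | nil =>
    intro s _
    have : ∀ ρ : ℕ → S, tourTime [] ρ = 0 := fun ρ => by
      have := firstTime_le (A := fun n => [] <+ pathOf (shiftSeq 1 ρ) n) (n := 0) (by simp)
      simpa [tourTime] using this
    simp [this]
  | cons a L ih =>
    intro s hs
    have ha := hL a (by simp)
    have h := (M.startAt s).lintegral_le_of_firstTime (A := fun ρ n => 1 ≤ n ∧ ρ n = a)
      (F := tourTime (a :: L)) (f := fun _ => tourTime L) (C := (C : Set S)) (k₁ := 0)
      (k₀ := L.length * T)
      (fun n => by
        rintro ρ ρ' h ⟨h1, h2⟩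
        exact ⟨h1, by rw [← h n le_rfl]; exact h2⟩)
      (ne_top_of_le_ne_top hT (hhit s hs a ha))
      (fun n => measurable_tourTime (fun _ => L))
      (Filter.Eventually.of_forall (fun ρ n h => by rw [h.2]; exact ha))
      (fun n u hu => by
        rw [mul_zero, zero_add]
        exact ih (fun x hx => hL x (by simp [hx])) u hu)
      (Filter.Eventually.of_forall (fun ρ n h _ => tourTime_cons_le h.1 h.2))
    refine h.trans ?_
    rw [add_zero, mul_one, List.length_cons]
    push_cast
    rw [add_mul, one_mul, add_comm]
    gcongr
    exact hhit s hs a ha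

end Tours

/-! ### The expected running time of a single simulation -/

section Strength

variable {p δ : ℝ}

lemma strength_denominator (hp : 0 < p) (hp1 : p ≤ 1 / 2) :
    0 < -Real.logb 2 (1 - p) ∧ -Real.logb 2 (1 - p) ≤ 1 := by
  constructor
  · have := Real.logb_neg (b := 2) (by norm_num) (show 0 < 1 - p by linarith) (by linarith)
    linarith
  · have h1 : Real.logb 2 (1 / 2) ≤ Real.logb 2 (1 - p) :=
      Real.logb_le_logb_of_le (by norm_num) (by norm_num) (by linarith)
    have h2 : Real.logb 2 (1 / 2) = -1 := by
      rw [one_div, Real.logb_inv, Real.logb_self_eq_one (by norm_num)]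
    linarith

lemma strength_mono (hp : 0 < p) (hp1 : p ≤ 1 / 2) {i j : ℝ} (h : i ≤ j) :
    strength p δ i ≤ strength p δ j :=
  div_le_div_of_nonneg_right (by linarith) (strength_denominator hp hp1).1.le

lemma strength_nonneg (hp : 0 < p) (hp1 : p ≤ 1 / 2) (hδ : 0 < δ) (hδ1 : δ < 1) {i : ℝ}
    (hi : 0 ≤ i) : 0 ≤ strength p δ i := by
  have := Real.logb_neg (b := 2) (by norm_num) hδ hδ1
  exact div_nonneg (by linarith) (strength_denominator hp hp1).1.le

lemma le_strength (hp : 0 < p) (hp1 : p ≤ 1 / 2) (hδ : 0 < δ) (hδ1 : δ < 1) {i : ℝ}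
    (hi : 0 ≤ i) : i ≤ strength p δ i := by
  have h := Real.logb_neg (b := 2) (by norm_num) hδ hδ1
  obtain ⟨h1, h2⟩ := strength_denominator hp hp1
  rw [strength, le_div_iff₀ h1]
  nlinarith

/-- With `k` the strength at `R + B`, the terms contribute `3 + 1 + 1 + 5 = 10` multiples of `k * B
* T`: the strength terms total at most `3 * k` because `1 + 2 * B ≤ 3 * B`, and `k ≥ R + B` covers
the other three. -/
lemma simulation_bound_real (hp : 0 < p) (hp1 : p ≤ 1 / 2) (hδ : 0 < δ) (hδ1 : δ < 1) {R B T : ℝ}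
    (hR : 0 ≤ R) (hB : 1 ≤ B) (hT : 1 ≤ T) :
    R * (1 + 1 / (-Real.logb 2 (1 - p)) * (B * T)) +
      (1 + (strength p δ (1 + 2 * B) + 5) * (B * T)) ≤ 10 * (strength p δ (R + B) * B * T) := by
  have hk := le_strength hp hp1 hδ hδ1 (i := R + B) (by linarith)
  have hg := Real.logb_neg (b := 2) (by norm_num) hδ hδ1
  obtain ⟨h1, h2⟩ := strength_denominator hp hp1
  set l := -Real.logb 2 (1 - p) with hl
  set k := strength p δ (R + B) with hkdef
  have hBT : 1 ≤ B * T := by nlinarith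
  have e1 : R * (1 / l) + strength p δ (1 + 2 * B) ≤ 3 * k := by
    rw [hkdef, strength, strength, ← hl, mul_one_div, ← add_div, ← mul_div_assoc]
    apply div_le_div_of_nonneg_right _ h1.le
    linarith
  have e2 : R ≤ k * (B * T) := by nlinarith
  have e3 : 1 ≤ k * (B * T) := by nlinarith
  have e4 := mul_le_mul_of_nonneg_right e1 (by linarith : 0 ≤ B * T)
  have e5 : B * T ≤ k * (B * T) := by nlinarith
  nlinarith

lemma ofReal_simulation_bound {R x y T : ℝ} (hR : 0 ≤ R) (hx : 0 ≤ x) (hy : 0 ≤ y) (hT : 0 ≤ T)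
    (B : ℕ) : ENNReal.ofReal R * (1 + ENNReal.ofReal x * (B * ENNReal.ofReal T)) +
      (1 + ENNReal.ofReal y * (B * ENNReal.ofReal T)) =
      ENNReal.ofReal (R * (1 + x * (B * T)) + (1 + y * (B * T))) := by
  rw [ENNReal.ofReal_add (by positivity) (by positivity), ENNReal.ofReal_mul hR,
    ENNReal.ofReal_add zero_le_one (by positivity), ENNReal.ofReal_mul hx,
    ENNReal.ofReal_add zero_le_one (by positivity), ENNReal.ofReal_mul hy,
    ENNReal.ofReal_mul (Nat.cast_nonneg _), ENNReal.ofReal_natCast, ENNReal.ofReal_one]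

end Strength

/-! ### Expected time until the test succeeds. -/

namespace MarkovChain

open scoped List

variable {V : Type*}

open Classical in
/-- A list of the states of a bottom component that contains `u`. -/
def tourFrom (N : MarkovChain V) (u : V) : List V :=
  if h : ∃ C, N.BSCC C ∧ u ∈ C then h.choose.toList else []

lemma exists_BSCC_tourFrom (N : MarkovChain V) {u : V} (h : ∃ C, N.BSCC C ∧ u ∈ C) :
    ∃ C, N.BSCC C ∧ u ∈ C ∧ N.tourFrom u = C.toList := by
  refine ⟨h.choose, h.choose_spec.1, h.choose_spec.2, ?_⟩
  rw [tourFrom, dif_pos h]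

/-- After the time `n` at which a run enters a bottom component, the test needs no more than a
number of tours of this component. -/
lemma firstTime_reachedBSCC_le [Fintype V] [DecidableEq V] (N : MarkovChain V) {p δ : ℝ} {ρ : ℕ → V}
    (hρ : ∀ n, N.edge (ρ n) (ρ (n + 1))) {n : ℕ} (hn : ∃ C, N.BSCC C ∧ ρ n ∈ C)
    (hmin : ∀ i < n, ¬ ∃ C, N.BSCC C ∧ ρ i ∈ C) {r : ℕ} (hr : 4 ≤ r)
    (hk : ∀ i : ℕ, i ≤ n + 1 + 2 * N.maxBSCC → strength p δ i + 3 ≤ r) :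
    firstTime (fun m => 1 ≤ m ∧ ReachedBSCC p δ (pathOf ρ m)) ≤
      n + (1 + tourTime (List.replicate r (N.tourFrom (ρ n))).flatten (shiftSeq n ρ)) := by
  obtain ⟨C, hC, hnC, htour⟩ := N.exists_BSCC_tourFrom hn
  by_cases htop : tourTime (List.replicate r (N.tourFrom (ρ n))).flatten (shiftSeq n ρ) = ⊤
  · rw [htop]; simp
  · obtain ⟨k, hkt, hkmin⟩ := exists_first (exists_of_firstTime_ne_top htop)
    have h1 : tourTime (List.replicate r (N.tourFrom (ρ n))).flatten (shiftSeq n ρ) = k :=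
      firstTime_eq hkt hkmin
    rw [h1]
    have hin : ∀ j, ρ (n + j) ∈ C := by
      intro j
      induction j with
      | zero => exact hnC
      | succ j ih => exact hC.closed _ ih _ (hρ (n + j))
    have hreach : ReachedBSCC p δ (pathOf ρ (n + (1 + k))) := by
      rw [pathOf_add]
      refine reachedBSCC_of_tours ⟨_, hnC⟩ (T := C.toList) (r := r) ?_ ?_ ?_ hr ?_ ?_
      · intro x hx hxC
        obtain ⟨i, hi, rfl⟩ := List.mem_map.1 hx
        exact hmin i (List.mem_range.1 hi) ⟨C, hC, hxC⟩
      · intro x hx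
        obtain ⟨i, -, rfl⟩ := List.mem_map.1 hx
        exact hin i
      · intro x hx; simpa using hx
      · rw [pathOf_add, ← htour]
        exact hkt.trans (List.sublist_append_right _ _)
      · intro i hi
        apply hk i
        have := N.card_le_maxBSCC hC
        simp only [pathOf, List.length_map, List.length_range] at hi
        omega
    have := firstTime_le (A := fun m => 1 ≤ m ∧ ReachedBSCC p δ (pathOf ρ m))
      (n := n + (1 + k)) ⟨by omega, hreach⟩
    exact_mod_cast this

variable [Fintype V] [MeasurableSpace V] [MeasurableSingletonClass V]

/-- The expected time until the test ReachedBSCC succeeds. -/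
lemma lintegral_reachedBSCC_le [DecidableEq V] (N : MarkovChain V) (hN : N.pmin < 1) {δ : ℝ}
    (hδ : 0 < δ) (hδ1 : δ < 1) :
    ∫⁻ ρ, firstTime (fun m => 1 ≤ m ∧ ReachedBSCC N.pmin δ (pathOf ρ m)) ∂N.runMeasure ≤
      ENNReal.ofReal (10 * N.bound N.pmin δ) := by
  set p := N.pmin with hpdef
  have hp : 0 < p := N.pmin_pos
  have hp1 : p ≤ 1 / 2 := N.pmin_le_half hN
  have hR := N.expReach_ne_top hN.le
  have hT := N.maxHit_ne_top hN.le
  have hBone : (1 : ℝ) ≤ N.maxBSCC := by exact_mod_cast N.one_le_maxBSCC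
  have hTone : 1 ≤ N.maxHit.toReal := by
    rw [← ENNReal.toReal_one]
    exact ENNReal.toReal_mono hT N.one_le_maxHit
  obtain ⟨hl0, hl1⟩ := strength_denominator hp hp1
  set l := -Real.logb 2 (1 - p) with hl
  set B := N.maxBSCC with hB
  -- The 4 covers both requirements of `reachedBSCC_of_tours`; rounding up costs at most one more
  -- tour, whence the 5 in `k₀`.
  set r : ℕ → ℕ := fun n => ⌈strength p δ (n + 1 + 2 * B)⌉₊ + 4 with hr
  set k₁ : ℝ≥0∞ := ENNReal.ofReal (1 / l) * (B * N.maxHit) with hk₁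
  set k₀ : ℝ≥0∞ := 1 + ENNReal.ofReal (strength p δ (1 + 2 * B) + 5) * (B * N.maxHit) with hk₀
  have hr_le : ∀ n : ℕ, (r n : ℝ≥0∞) ≤
      n * ENNReal.ofReal (1 / l) + ENNReal.ofReal (strength p δ (1 + 2 * B) + 5) := by
    intro n
    have hs0 : 0 ≤ strength p δ (1 + 2 * B) := strength_nonneg hp hp1 hδ hδ1 (by positivity)
    rw [← ENNReal.ofReal_natCast n, ← ENNReal.ofReal_natCast (r n), ← ENNReal.ofReal_mul
      (by positivity), ← ENNReal.ofReal_add (by positivity) (by linarith)]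
    apply ENNReal.ofReal_le_ofReal
    have hceil := Nat.ceil_lt_add_one
      (strength_nonneg hp hp1 hδ hδ1 (i := n + 1 + 2 * B) (by positivity))
    -- Affinity in the entry time: only the mean `R` of that time will matter.
    have hsplit : strength p δ (n + 1 + 2 * B) = n * (1 / l) + strength p δ (1 + 2 * B) := by
      rw [strength, strength, ← hl]; ring
    rw [hr]
    push_cast
    linarith
  have main := N.lintegral_le_of_firstTime (A := fun ρ n => ∃ C, N.BSCC C ∧ ρ n ∈ C)
    (F := fun ρ => firstTime (fun m => 1 ≤ m ∧ ReachedBSCC p δ (pathOf ρ m)))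
    (f := fun n ρ => 1 + tourTime (List.replicate (r n) (N.tourFrom (ρ 0))).flatten ρ)
    (C := {u | ∃ C, N.BSCC C ∧ u ∈ C}) (k₁ := k₁) (k₀ := k₀)
    (fun n => prefixDetermined_eval le_rfl {u | ∃ C, N.BSCC C ∧ u ∈ C}) hR
    (fun n => measurable_const.add
      (measurable_tourTime (fun u => (List.replicate (r n) (N.tourFrom u)).flatten)))
    (Filter.Eventually.of_forall (fun ρ n h => h))
    (fun n u hu => by
      obtain ⟨C, hC, huC, htour⟩ := N.exists_BSCC_tourFrom hu
      rw [lintegral_add_left measurable_const, lintegral_const, measure_univ, mul_one]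
      have h1 : ∫⁻ ρ, tourTime (List.replicate (r n) (N.tourFrom (ρ 0))).flatten ρ
          ∂(N.startAt u).runMeasure =
          ∫⁻ ρ, tourTime (List.replicate (r n) C.toList).flatten ρ ∂(N.startAt u).runMeasure := by
        apply lintegral_congr_ae
        filter_upwards [N.startAt_runMeasure_zero u] with ρ hρ
        rw [hρ, htour]
      have h2 := N.lintegral_tourTime_le hT (fun s hs s' hs' => N.expHit_le_maxHit hC hs hs')
        (L := (List.replicate (r n) C.toList).flatten) (by
          intro x hx
          obtain ⟨_, hl, hx⟩ := List.mem_flatten.1 hx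
          rw [(List.mem_replicate.1 hl).2] at hx
          simpa using hx) u huC
      rw [h1]
      have h3 : (List.replicate (r n) C.toList).flatten.length = r n * C.card := by
        simp [List.length_flatten]
      rw [h3] at h2
      have h4 : ((r n * C.card : ℕ) : ℝ≥0∞) * N.maxHit ≤ (r n : ℝ≥0∞) * (B * N.maxHit) := by
        push_cast
        rw [mul_assoc]
        gcongr
        exact N.card_le_maxBSCC hC
      calc 1 + ∫⁻ ρ, tourTime (List.replicate (r n) C.toList).flatten ρ
            ∂(N.startAt u).runMeasure ≤ 1 + (r n : ℝ≥0∞) * (B * N.maxHit) := by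
            gcongr; exact h2.trans h4
        _ ≤ 1 + (n * ENNReal.ofReal (1 / l) + ENNReal.ofReal (strength p δ (1 + 2 * B) + 5)) *
            (B * N.maxHit) := by gcongr; exact hr_le n
        _ = n * k₁ + k₀ := by rw [hk₁, hk₀]; ring)
    (by
      filter_upwards [N.ae_edge] with ρ hρ n hn hmin
      refine N.firstTime_reachedBSCC_le hρ hn hmin (r := r n) (by simp [hr]) (fun i hi => ?_)
      have h1 : strength p δ i ≤ strength p δ (n + 1 + 2 * B) :=
        strength_mono hp hp1 (by exact_mod_cast hi)
      have h2 := Nat.le_ceil (strength p δ (n + 1 + 2 * B))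
      rw [hr]
      push_cast
      linarith)
  refine main.trans ?_
  rw [show ∫⁻ ρ, firstTime (fun n => ∃ C, N.BSCC C ∧ ρ n ∈ C) ∂N.runMeasure = N.expReach from rfl,
    hk₁, hk₀]
  have hs0 : 0 ≤ strength p δ (1 + 2 * B) := strength_nonneg hp hp1 hδ hδ1 (by positivity)
  have hTr : N.maxHit = ENNReal.ofReal N.maxHit.toReal := (ENNReal.ofReal_toReal hT).symm
  have hRr : N.expReach = ENNReal.ofReal N.expReach.toReal := (ENNReal.ofReal_toReal hR).symm
  have hR0 : 0 ≤ N.expReach.toReal := ENNReal.toReal_nonneg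
  have hreal := simulation_bound_real hp hp1 hδ hδ1 hR0 hBone hTone
  rw [← hl] at hreal
  refine le_trans (le_of_eq ?_) (ENNReal.ofReal_le_ofReal hreal)
  conv_lhs => rw [hTr, hRr]
  exact ofReal_simulation_bound hR0 (by positivity) (by positivity) ENNReal.toReal_nonneg B

lemma bound_nonneg (N : MarkovChain V) {p δ : ℝ} (hp : 0 < p) (hp1 : p ≤ 1 / 2) (hδ : 0 < δ)
    (hδ1 : δ < 1) : 0 ≤ N.bound p δ :=
  mul_nonneg (mul_nonneg (strength_nonneg hp hp1 hδ hδ1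
    (add_nonneg ENNReal.toReal_nonneg (Nat.cast_nonneg _))) (Nat.cast_nonneg _))
    ENNReal.toReal_nonneg

end MarkovChain

/-! ### Measurability and running times of the single-path loops. -/

section SinglePath

variable {V : Type*} [Fintype V] [MeasurableSpace V] [MeasurableSingletonClass V]

lemma measurableSet_pathOf (P : List V → Prop) (n : ℕ) :
    MeasurableSet {ρ : ℕ → V | P (pathOf ρ n)} := by
  refine PrefixDetermined.measurableSet (n := n) (fun ρ ρ' h hρ => ?_)
  rw [Set.mem_ofPred_eq] at hρ ⊢
  rwa [← pathOf_congr (fun i hi => h i hi.le)]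

lemma measurable_runTime (test : List V → Option Bool) :
    Measurable (fun ρ : ℕ → V => runTime test ρ) :=
  measurable_firstTime (fun n => measurableSet_pathOf (fun π => 1 ≤ n ∧ test π ≠ none) n)

lemma measurableSet_returnsYes (test : List V → Option Bool) :
    MeasurableSet {ρ : ℕ → V | ReturnsYes test ρ} := by
  have h : {ρ : ℕ → V | ReturnsYes test ρ} = ⋃ n : ℕ, {ρ | 1 ≤ n ∧ test (pathOf ρ n) = some true ∧
      ∀ m, 1 ≤ m → m < n → test (pathOf ρ m) = none} := by
    ext ρ; simp [ReturnsYes]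
  rw [h]
  refine MeasurableSet.iUnion (fun n => PrefixDetermined.measurableSet (n := n) ?_)
  rintro ρ ρ' h ⟨h1, h2, h3⟩
  refine ⟨h1, ?_, fun m hm hmn => ?_⟩
  · rwa [← pathOf_congr (fun i hi => h i hi.le)]
  · rw [← pathOf_congr (fun i hi => h i (by omega))]
    exact h3 m hm hmn

lemma runTime_reachTest_le {V : Type*} [DecidableEq V] (G : Set V) (p δ : ℝ) (ρ : ℕ → V) :
    runTime (reachTest G p δ) ρ ≤
      firstTime (fun m => 1 ≤ m ∧ ReachedBSCC p δ (pathOf ρ m)) := by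
  refine firstTime_mono (fun n hn => ⟨hn.1, ?_⟩)
  unfold reachTest
  rw [if_pos hn.2]
  split_ifs <;> simp

lemma runTime_ltlTest_le {Ap Q S : Type*} [DecidableEq S] [DecidableEq Q] (A : DRA Ap Q) (p δ : ℝ)
    (ρ : ℕ → S × Q) : runTime (ltlTest A p δ) ρ ≤
      firstTime (fun m => 1 ≤ m ∧ ReachedBSCC p δ (pathOf ρ m)) := by
  refine firstTime_mono (fun n hn => ⟨hn.1, ?_⟩)
  unfold ltlTest
  rw [if_pos hn.2]
  simp

end SinglePath

end
theorem theorem6 :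
    ∃ c : ℝ, 0 < c ∧ ∀ κ : ℝ, 0 < κ → ∃ d : ℝ, 0 < d ∧
      ∀ (S : Type*) [Fintype S] [DecidableEq S] [MeasurableSpace S] [MeasurableSingletonClass S]
        (M : MarkovChain S), M.pmin < 1 →
      ∀ p ε δ α β : ℝ, 0 < ε → δ = ε / 2 → 0 < p - ε + δ → p + ε - δ < 1 →
        0 < α → 0 < β → α + β < 1 →
      -- reachability
      (M.expReach ≠ ∞ ∧
        M.maxHit ≤ ENNReal.ofReal (M.maxBSCC / M.pmin ^ M.maxBSCC) ∧
        ∀ G : Set S,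
          ∫⁻ ρ, runTime (reachTest G M.pmin δ) ρ ∂M.runMeasure
              ≤ ENNReal.ofReal (c * M.bound M.pmin δ) ∧
          (κ * Real.log ((p + ε - δ) / (p - ε + δ)) ≤ Real.log ((1 - α) / β) →
            κ * Real.log ((1 - p + ε - δ) / (1 - p - ε + δ)) ≤ Real.log ((1 - β) / α) →
            ∀ θ₁ : ℝ, 0 < θ₁ → p - ε ≤ θ₁ → θ₁ ≤ p - ε + δ →
              sprtTime M.runMeasure
                  (ReturnsYes (reachTest G M.pmin δ)) (runTime (reachTest G M.pmin δ))
                  (p + ε - δ) θ₁ α β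
                ≤ ENNReal.ofReal (d * (sim p ε δ α β * M.bound M.pmin δ)))) ∧
      -- LTL and all other omega-regular properties, with `R`, `B` and `T` of the product chain
      ∀ (Ap Q : Type*) [Fintype Q] [DecidableEq Q] [MeasurableSpace Q] [MeasurableSingletonClass Q]
        (L : S → Set Ap) (A : DRA Ap Q),
        (M.product L A).expReach ≠ ∞ ∧
        (M.product L A).maxHit ≤
          ENNReal.ofReal ((M.product L A).maxBSCC / M.pmin ^ (M.product L A).maxBSCC) ∧
        ∫⁻ ρ, runTime (ltlTest A M.pmin δ) (A.lift L ρ) ∂M.runMeasure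
            ≤ ENNReal.ofReal (c * (M.product L A).bound M.pmin δ) ∧
        (κ * Real.log ((p + ε - δ) / (p - ε + δ)) ≤ Real.log ((1 - α) / β) →
          κ * Real.log ((1 - p + ε - δ) / (1 - p - ε + δ)) ≤ Real.log ((1 - β) / α) →
          sprtTime M.runMeasure
              (fun ρ => ReturnsYes (ltlTest A M.pmin δ) (A.lift L ρ))
              (fun ρ => runTime (ltlTest A M.pmin δ) (A.lift L ρ))
              (p + ε - δ) (p - ε + δ) α β
            ≤ ENNReal.ofReal (d * (sim p ε δ α β * (M.product L A).bound M.pmin δ))) := by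
  refine ⟨10, by norm_num, fun κ hκ => ⟨40 * (1 + 1 / κ) ^ 2, by positivity, ?_⟩⟩
  intro S _ _ _ _ M hM p ε δ α β hε hδ h0 h1 hα hβ hαβ
  have hδ0 : 0 < δ := by linarith
  have hδ1 : δ < 1 := by linarith
  have hp0 := M.pmin_pos
  have hp1 := M.pmin_le_half hM
  -- The constant 40 is 4 from the exit time of the walk times 10 from a single run.
  have combine : ∀ {s b : ℝ} {t c : ℝ≥0∞}, 0 ≤ b → c ≤ ENNReal.ofReal (10 * b) →
      t ≤ ENNReal.ofReal (4 * (1 + 1 / κ) ^ 2 * s) * c →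
      t ≤ ENNReal.ofReal (40 * (1 + 1 / κ) ^ 2 * (s * b)) := by
    intro s b t c hb hc ht
    calc t ≤ ENNReal.ofReal (4 * (1 + 1 / κ) ^ 2 * s) * ENNReal.ofReal (10 * b) :=
          ht.trans (by gcongr)
      _ = ENNReal.ofReal (40 * (1 + 1 / κ) ^ 2 * (s * b)) := by
          rw [← ENNReal.ofReal_mul' (by positivity)]
          congr 1
          ring
  refine ⟨⟨M.expReach_ne_top hM.le, M.maxHit_le hM.le, fun G => ?_⟩, fun Ap Q _ _ _ _ L A => ?_⟩
  · have hrun : ∫⁻ ρ, runTime (reachTest G M.pmin δ) ρ ∂M.runMeasure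
        ≤ ENNReal.ofReal (10 * M.bound M.pmin δ) :=
      (lintegral_mono (fun ρ => runTime_reachTest_le G M.pmin δ ρ)).trans
        (M.lintegral_reachedBSCC_le hM hδ0 hδ1)
    refine ⟨hrun, fun hκa hκb θ₁ hθ _ hθ1 => ?_⟩
    exact combine (M.bound_nonneg hp0 hp1 hδ0 hδ1) hrun
      (sprtTime_le M.runMeasure (measurableSet_returnsYes _) (measurable_runTime _) hε hδ h0 h1
        hα hβ hαβ hκ hκa hκb hθ hθ1)
  · have hpN := MarkovChain.pmin_product M L A
    have hN : (M.product L A).pmin < 1 := by rw [hpN]; exact hM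
    have hmeas := measurable_runTime (V := S × Q) (ltlTest A M.pmin δ)
    have hlift := A.measurable_lift L
    have hrun : ∫⁻ ρ, runTime (ltlTest A M.pmin δ) (A.lift L ρ) ∂M.runMeasure
        ≤ ENNReal.ofReal (10 * (M.product L A).bound M.pmin δ) := by
      -- The cost depends on the run only through its lift, so it may be integrated over the product
      -- chain.
      rw [← lintegral_map hmeas hlift, ← M.product_runMeasure L A]
      refine (lintegral_mono (fun ρ => runTime_ltlTest_le A M.pmin δ ρ)).trans ?_
      rw [← hpN]
      exact (M.product L A).lintegral_reachedBSCC_le hN hδ0 hδ1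
    refine ⟨(M.product L A).expReach_ne_top hN.le, ?_, hrun, fun hκa hκb => ?_⟩
    · have h := (M.product L A).maxHit_le hN.le
      rwa [hpN] at h
    · exact combine ((M.product L A).bound_nonneg hp0 hp1 hδ0 hδ1) hrun
        (sprtTime_le M.runMeasure (hlift (measurableSet_returnsYes (ltlTest A M.pmin δ))) (hmeas.comp hlift) hε hδ
          h0 h1 hα hβ hαβ hκ hκa hκb h0 le_rfl)
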